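/- All spaces are compactly generated Hausdorff, and products and mapping spaces carry the compactly generated topology. Let $K_n$ be the space of metric trees with $n$ leaves: planar rooted trees with $n$ leaves, each vertex having at least two inputs, whose internal edges have lengths in $[0,1]$, where an edge of length $0$ is identified with its collapse; $K_0$ and $K_1$ are points, and $\delta_n\in K_n$ is the tree without internal edges. Write $T\circ_i^r S$ for the tree obtained by grafting the root of $S$ on the $i$-th leaf of $T$, the new edge having length $r$, and $T\circ_i S=T\circ_i^1 S$; here $\delta_1$ is an identity, and $T\circ_i\delta_0$ is $T$ with the $i$-th leaf erased (if a vertex is left with one input, it is erased; if both adjacent edges are internal, the merged edge gets the maximum of the two lengths, and otherwise the merged edge is external). An $A_\infty$-space is an algebra $X=(X,\{M_n:K_n\times X^n\to X\}_{n\ge 0})$ over the operad $\{K_n\}_{n\geq 0}$. A left $A_\infty$-action $X\multimap P$ consists of maps $N_n:K_n\times X^{n-1}\times P\to P$, $n\ge1$, with $N_1=\mathrm{Id}_P$, such that $N(\rho\circ_j\tau;\dots)$ is obtained by first applying $M_{|\tau|}(\tau;-)$ (if $j<|\rho|$, $|\tau|\ge 0$) or $N_{|\tau|}(\tau;-)$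 (if $j=|\rho|$, $|\tau|\ge 1$) to the entries on the leaves of $\tau$ and then applying $N_{|\rho|}(\rho;-)$. Right actions $R_n:K_n\times Q\times X^{n-1}\to Q$ are defined symmetrically; $X$ acts on itself from the right by $R_n=M_n$, and trivially on the point $\ast$. For a right action on $Q$ and a left action on $P$, let $$B(Q,X,P)=\Bigl(\coprod_{n\ge0}K_{n+2}\times Q\times X^n\times P\Bigr)\Big/\equiv ,$$ with the quotient topology, where $\equiv$ is the equivalence relation generated by $$(\rho\circ_{i+1}\tau;x_0,\dots,x_{n+1})\equiv(\rho;x_0,\dots,x_{i-1},E(\tau;x_i,\dots,x_{i+|\tau|-1}),x_{i+|\tau|},\dots,x_{n+1})$$ for $|\rho|\ge2$, $|\tau|\ge1$, $0\le i\le|\rho|-1$, with $E=R,M,N$ according to whether $\tau$ is grafted on the first, a middle or the last leaf of $\rho$. The class of $(T;q,x_1,\dots,x_n,p)$ is denoted $[T;q,x_{[n]},p]$. For a space $B$, let $\mathrm{M}_{\mathrm{path}}(B)$ be the space of Moore paths, i.e. of pairs $(\gamma,r)$ with $r\ge0$ and $\gamma:[0,\infty)\to B$ continuous such that $\gamma(t)=\gamma(r)$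 for all $t\ge r$; $r$ is the length. **Corollary.** For every $A_\infty$-space $X$ and every left $A_\infty$-action $X\multimap P$ there is a continuous map $$\alpha_P:B(X,X,P)\to \mathrm{M}_{\mathrm{path}}(B(\ast,X,P)),$$ all of whose values are Moore paths of length $1$, such that for all $n\ge0$, $T\in K_{n+2}$, $x\in X$, $x_{[n]}=(x_1,\dots,x_n)\in X^n$, $p\in P$, $$\alpha_P([T;x,x_{[n]},p])(0)=[\delta_2;\ast,N_{n+2}(T;x,x_{[n]},p)],\qquad \alpha_P([T;x,x_{[n]},p])(1)=[T;\ast,x_{[n]},p],$$ and for all $x\in X$, $p\in P$, $$\alpha_P([\delta_2;x,p])(t)=\begin{cases}[\delta_2\circ_2^{1-2t}\delta_2;\ast,x,p],&0\le t\le\tfrac12,\\ [\delta_2\circ_1^{2t-1}\delta_2;\ast,x,p],&\tfrac12\le t\le1.\end{cases}$$ -/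

import Mathlib

open scoped NNReal Topology

/-! ### Metric trees

A planar rooted tree with `n` leaves (numbered `0, …, n - 1` from left to right) all of whose
vertices have at least two inputs is recorded by its internal edges. The internal edge above which
exactly the leaves `a, a + 1, …, b` lie is recorded as the pair `(a, b)`; such a set of leaves has
at least two elements and is not the set of all leaves, and two of them are nested or disjoint.
Conversely each set of pairwise nested or disjoint pairs of this kind comes from exactly one tree.
For `n = 0` and `n = 1` there is no such pair, so that there is just one tree in these cases. -/

/-- `e` is a possible internal edge of a planar tree with `n` leaves. -/
def IsEdge (n : ℕ) (e : ℕ × ℕ) : Prop := e.1 < e.2 ∧ e.2 < n ∧ e.2 + 1 < n + e.1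

instance (n : ℕ) (e : ℕ × ℕ) : Decidable (IsEdge n e) := by unfold IsEdge; infer_instance

/-- The leaves above `e` and the leaves above `f` form disjoint or nested sets. -/
def NestedOrDisjoint (e f : ℕ × ℕ) : Prop :=
  e.2 < f.1 ∨ f.2 < e.1 ∨ (f.1 ≤ e.1 ∧ e.2 ≤ f.2) ∨ (e.1 ≤ f.1 ∧ f.2 ≤ e.2)

/-- Planar rooted trees with `n` leaves and at least two inputs at each vertex. -/
@[ext] structure PlanarTree (n : ℕ) where
  edges : Finset (ℕ × ℕ)
  isEdge : ∀ e ∈ edges, IsEdge n e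
  nested : ∀ e ∈ edges, ∀ f ∈ edges, NestedOrDisjoint e f

/-- Edge-labeled trees with `n` leaves: the disjoint union over all trees of the cubes of
labelings of their internal edges by numbers in `[0, 1]`. -/
abbrev LabeledTree (n : ℕ) : Type := Σ T : PlanarTree n, (T.edges → unitInterval)

namespace LabeledTree

variable {n : ℕ}

/-- The length of an edge, extended by `0` to all pairs which are not edges of the tree. -/
noncomputable def len (T : LabeledTree n) (e : ℕ × ℕ) : unitInterval :=
  if h : e ∈ T.1.edges then T.2 ⟨e, h⟩ else 0

/-- Collapsing the edge `e` to a vertex. -/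
def collapse (T : LabeledTree n) (e : ℕ × ℕ) : LabeledTree n :=
  ⟨⟨T.1.edges.erase e, fun f hf => T.1.isEdge f (Finset.mem_of_mem_erase hf),
    fun f hf g hg => T.1.nested f (Finset.mem_of_mem_erase hf) g (Finset.mem_of_mem_erase hg)⟩,
    fun f => T.2 ⟨f.1, Finset.mem_of_mem_erase f.2⟩⟩

/-- `T'` arises from `T` by collapsing an internal edge of length `0`. -/
def Collapses (T T' : LabeledTree n) : Prop :=
  ∃ e, ∃ he : e ∈ T.1.edges, T.2 ⟨e, he⟩ = 0 ∧ T' = T.collapse e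

end LabeledTree

/-- The space `K n` of metric trees with `n` leaves: edge-labeled trees modulo collapsing internal
edges of length `0`, with the quotient topology. `K 0` and `K 1` are one point spaces. -/
def MetricTree (n : ℕ) : Type := Quot (LabeledTree.Collapses (n := n))

instance (n : ℕ) : TopologicalSpace (MetricTree n) :=
  inferInstanceAs (TopologicalSpace (Quot (LabeledTree.Collapses (n := n))))

/-- The corolla with `n` leaves, i.e. the tree without internal edges. `corolla 1` is the tree
without vertices and `corolla 0` is the only point of `K 0`. -/
def corolla (n : ℕ) : MetricTree n :=
  Quot.mk _ ⟨⟨∅, by simp, by simp⟩, fun _ => 0⟩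

namespace LabeledTree

variable {n m N : ℕ}

/-- The labeled tree with given underlying tree whose labels are the values of `L`. -/
def ofLen (L : ℕ × ℕ → unitInterval) (S : PlanarTree n) : LabeledTree n := ⟨S, fun f => L f⟩

lemma len_ofLen (L : ℕ × ℕ → unitInterval) (S : PlanarTree n) (e : ℕ × ℕ) :
    (ofLen L S).len e = if e ∈ S.edges then L e else 0 := by
  unfold len ofLen
  split_ifs <;> rfl

lemma len_eq_zero {T : LabeledTree n} {e : ℕ × ℕ} (h : e ∉ T.1.edges) : T.len e = 0 := by
  simp [len, h]

lemma len_of_collapses {T T' : LabeledTree n} (h : T.Collapses T') : T.len = T'.len := by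
  obtain ⟨e, he, h0, rfl⟩ := h
  funext f
  by_cases hf : f = e
  · subst hf
    simp [len, collapse, he, h0]
  · by_cases hm : f ∈ T.1.edges
    · simp [len, collapse, hf, hm]
    · simp [len, collapse, hm]

/-- Collapsing all edges of length `0`. -/
noncomputable def reduce (T : LabeledTree n) : LabeledTree n :=
  ofLen T.len ⟨T.1.edges.filter (fun e => T.len e ≠ 0),
    fun e he => T.1.isEdge e (Finset.mem_of_mem_filter e he),
    fun e he f hf => T.1.nested e (Finset.mem_of_mem_filter e he) f
      (Finset.mem_of_mem_filter f hf)⟩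

lemma reduce_eq {T T' : LabeledTree n} (h : T.len = T'.len) : T.reduce = T'.reduce := by
  unfold reduce
  simp only [h]
  congr 2
  ext e
  simp only [Finset.mem_filter]
  constructor
  · rintro ⟨_, h0⟩
    exact ⟨by_contra fun hc => h0 (len_eq_zero hc), h0⟩
  · rintro ⟨_, h0⟩
    exact ⟨by_contra fun hc => h0 (by rw [← h]; exact len_eq_zero hc), h0⟩

lemma mk_reduce (k : ℕ) : ∀ T : LabeledTree n, T.1.edges.card = k →
    Quot.mk Collapses T = Quot.mk Collapses T.reduce := by
  induction k with
  | zero =>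
    intro T hT
    have h : T.reduce = T := by
      obtain ⟨S, l⟩ := T
      have hS : S.edges = ∅ := Finset.card_eq_zero.mp hT
      obtain ⟨E, h1, h2⟩ := S
      simp only at hS
      subst hS
      unfold reduce ofLen
      refine Sigma.ext (by simp) ?_
      refine Function.hfunext (by simp) ?_
      intro a
      exact absurd a.2 (by simp)
    rw [h]
  | succ k ih =>
    intro T hT
    by_cases hz : ∃ e, ∃ he : e ∈ T.1.edges, T.2 ⟨e, he⟩ = 0
    · obtain ⟨e, he, h0⟩ := hz
      have hc : T.Collapses (T.collapse e) := ⟨e, he, h0, rfl⟩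
      rw [Quot.sound hc, reduce_eq (len_of_collapses hc)]
      apply ih
      simp only [collapse]
      rw [Finset.card_erase_of_mem he, hT]
      rfl
    · push Not at hz
      have h : T.reduce = T := by
        obtain ⟨S, l⟩ := T
        have hE : S.edges.filter (fun e => len (⟨S, l⟩ : LabeledTree n) e ≠ 0) = S.edges := by
          apply Finset.filter_true_of_mem
          intro e he
          have := hz e he
          simpa [len, he] using this
        have hS : (⟨S.edges.filter (fun e => len (⟨S, l⟩ : LabeledTree n) e ≠ 0),
            fun e he => S.isEdge e (Finset.mem_of_mem_filter e he),
            fun e he f hf => S.nested e (Finset.mem_of_mem_filter e he) f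
              (Finset.mem_of_mem_filter f hf)⟩ : PlanarTree n) = S :=
          PlanarTree.ext hE
        unfold reduce
        rw [hS]
        unfold ofLen
        congr 1
        funext f
        simp [len]
      rw [h]

/-- Two labeled trees define the same metric tree if their lengths (extended by `0`) agree. -/
lemma mk_eq_of_len_eq {T T' : LabeledTree n} (h : T.len = T'.len) :
    (Quot.mk Collapses T : MetricTree n) = Quot.mk Collapses T' := by
  exact (mk_reduce _ T rfl).trans ((congrArg _ (reduce_eq h)).trans (mk_reduce _ T' rfl).symm)

/-! ### Grafting

The root of a tree with `m` leaves is grafted on the leaf `i` of a tree with `n` leaves. If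
`m = 0`, this erases the leaf `i`. -/

/-- The edge of the grafted tree which comes from the edge `e` of the lower tree: the leaf `i` is
replaced by the leaves `i, …, i + m - 1`. -/
def lowerEdge (m i : ℕ) (e : ℕ × ℕ) : ℕ × ℕ :=
  (if e.1 ≤ i then e.1 else e.1 + m - 1, if e.2 < i then e.2 else e.2 + m - 1)

/-- The edge of the grafted tree which comes from the edge `e` of the upper tree. -/
def upperEdge (i : ℕ) (e : ℕ × ℕ) : ℕ × ℕ := (i + e.1, i + e.2)

/-- The tree obtained by grafting `S` on the leaf `i` of `T`. A new edge `(i, i + m - 1)` is created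
when `n` and `m` are at least `2`. Pairs which are not internal edges any more (this happens if `m`
or `n` is less than `2`: they have become the root or a leaf) are removed. -/
def graftTree (h : N + 1 = n + m) (i : ℕ) (hi : i < n)
    (T : PlanarTree n) (S : PlanarTree m) : PlanarTree N where
  edges := (T.edges.image (lowerEdge m i) ∪ S.edges.image (upperEdge i) ∪
    {(i, i + m - 1)}).filter (IsEdge N)
  isEdge e he := (Finset.mem_filter.mp he).2
  nested := by
    intro e he f hf
    simp only [Finset.mem_filter, Finset.mem_union, Finset.mem_image, Finset.mem_singleton]
      at he hf
    obtain ⟨he, he'⟩ := he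
    obtain ⟨hf, hf'⟩ := hf
    rcases he with (⟨a, ha, rfl⟩ | ⟨a, ha, rfl⟩) | rfl <;>
    rcases hf with (⟨b, hb, rfl⟩ | ⟨b, hb, rfl⟩) | rfl
    · have h1 := T.isEdge a ha
      have h2 := T.isEdge b hb
      have h3 := T.nested a ha b hb
      simp only [IsEdge, NestedOrDisjoint, lowerEdge] at *
      split_ifs at * <;> omega
    · have h1 := T.isEdge a ha
      have h2 := S.isEdge b hb
      simp only [IsEdge, NestedOrDisjoint, lowerEdge, upperEdge] at *
      split_ifs at * <;> omega
    · have h1 := T.isEdge a ha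
      simp only [IsEdge, NestedOrDisjoint, lowerEdge] at *
      split_ifs at * <;> omega
    · have h1 := S.isEdge a ha
      have h2 := T.isEdge b hb
      simp only [IsEdge, NestedOrDisjoint, lowerEdge, upperEdge] at *
      split_ifs at * <;> omega
    · have h3 := S.nested a ha b hb
      simp only [NestedOrDisjoint, upperEdge] at *
      omega
    · have h1 := S.isEdge a ha
      simp only [IsEdge, NestedOrDisjoint, upperEdge] at *
      omega
    · have h2 := T.isEdge b hb
      simp only [IsEdge, NestedOrDisjoint, lowerEdge] at *
      split_ifs at * <;> omega
    · have h2 := S.isEdge b hb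
      simp only [IsEdge, NestedOrDisjoint, upperEdge] at *
      omega
    · simp only [NestedOrDisjoint]
      omega

/-- The length of the edge `J` of the grafted tree: the maximum of the lengths of the edges which
`J` comes from, where the new edge has length `r`. If `m ≥ 1`, an edge comes from only one edge. If
`m = 0`, i.e. if the leaf `i` is erased, it may come from two edges: these are the two edges at a
vertex that is left with only one input, which is then erased as well. -/
noncomputable def graftLen (n m i : ℕ) (r : unitInterval) (L L' : ℕ × ℕ → unitInterval)
    (J : ℕ × ℕ) : unitInterval :=
  ((Finset.range n ×ˢ Finset.range n).filter (fun e => lowerEdge m i e = J)).sup L ⊔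
  ((Finset.range m ×ˢ Finset.range m).filter (fun e => upperEdge i e = J)).sup L' ⊔
  (if J = (i, i + m - 1) then r else 0)

/-- The grafting `T ∘ᵢ^r S` of labeled trees, with a new edge of length `r`. -/
noncomputable def graft (r : unitInterval) (h : N + 1 = n + m) (i : ℕ) (hi : i < n)
    (T : LabeledTree n) (S : LabeledTree m) : LabeledTree N :=
  ofLen (graftLen n m i r T.len S.len) (graftTree h i hi T.1 S.1)

lemma len_graft (r : unitInterval) (h : N + 1 = n + m) (i : ℕ) (hi : i < n)
    (T : LabeledTree n) (S : LabeledTree m) :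
    (graft r h i hi T S).len = fun J => if IsEdge N J then graftLen n m i r T.len S.len J else 0 := by
  funext J
  unfold graft
  rw [len_ofLen]
  by_cases hJ : IsEdge N J
  · rw [if_pos hJ]
    split_ifs with hm
    · rfl
    · simp only [graftTree, Finset.mem_filter, Finset.mem_union, Finset.mem_image,
        Finset.mem_singleton, hJ, and_true, not_or, not_exists, not_and] at hm
      obtain ⟨⟨h1, h2⟩, h3⟩ := hm
      symm
      unfold graftLen
      rw [if_neg h3]
      have hz : (0 : unitInterval) = ⊥ := rfl
      rw [hz, sup_eq_bot_iff, sup_eq_bot_iff, Finset.sup_eq_bot_iff, Finset.sup_eq_bot_iff]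
      refine ⟨⟨fun e he => ?_, fun e he => ?_⟩, rfl⟩
      · exact len_eq_zero fun hc => h1 e hc (Finset.mem_filter.mp he).2
      · exact len_eq_zero fun hc => h2 e hc (Finset.mem_filter.mp he).2
  · rw [if_neg hJ, if_neg]
    exact fun hc => hJ (Finset.mem_filter.mp hc).2

end LabeledTree

namespace MetricTree

variable {n m N : ℕ}

/-- The grafting `T ∘ᵢ^r S` of metric trees: `S` is grafted on the leaf `i` of `T` (leaves are
numbered from `0`) and the new edge gets the length `r`. If `T` or `S` has just one leaf, it acts as
the identity, and grafting the point of `K 0` erases the leaf `i`; no new edge arises then. -/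
noncomputable def graft (r : unitInterval) (h : N + 1 = n + m) (i : ℕ) (hi : i < n)
    (T : MetricTree n) (S : MetricTree m) : MetricTree N :=
  Quot.lift (fun T : LabeledTree n => Quot.lift
      (fun S : LabeledTree m => (Quot.mk _ (LabeledTree.graft r h i hi T S) : MetricTree N))
      (fun S S' hS => LabeledTree.mk_eq_of_len_eq (by
        rw [LabeledTree.len_graft, LabeledTree.len_graft, LabeledTree.len_of_collapses hS])) S)
    (fun T T' hT => by
      induction S using Quot.ind
      exact LabeledTree.mk_eq_of_len_eq (by
        rw [LabeledTree.len_graft, LabeledTree.len_graft, LabeledTree.len_of_collapses hT])) T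

/-- The composition `T ∘ᵢ S` of the operad of metric trees. -/
noncomputable def comp (h : N + 1 = n + m) (i : ℕ) (hi : i < n)
    (T : MetricTree n) (S : MetricTree m) : MetricTree N :=
  graft 1 h i hi T S

end MetricTree

/-! ### `A∞`-spaces and `A∞`-actions

All products carry the compactly generated topology. -/

/-- Continuity of a map on `A` with respect to the compactly generated topology associated with the
given one. -/
def KContinuous {A B : Type*} [TopologicalSpace A] [TopologicalSpace B] (f : A → B) : Prop :=
  Continuous fun z : CompactCoherentification A => f ((CompactCoherentification.mk A).symm z)

section Tuples

variable {A : Type*} {n m N : ℕ}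

/-- The block `(xᵢ, …, xᵢ₊ₘ₋₁)` of a tuple `x`. -/
def block (h : N + 1 = n + m) (i : ℕ) (hi : i < n) (x : Fin N → A) : Fin m → A :=
  fun k => x ⟨i + k, by omega⟩

/-- The tuple in which the block `(xᵢ, …, xᵢ₊ₘ₋₁)` of `x` is replaced by the single entry `z`. -/
def contract (h : N + 1 = n + m) (i : ℕ) (hi : i < n) (x : Fin N → A) (z : A) : Fin n → A :=
  fun j => if hj : j.1 < i then x ⟨j, by omega⟩
    else if hj' : j.1 = i then z else x ⟨j + m - 1, by omega⟩

end Tuples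

/-- `A∞`-spaces (with strict unit): algebras over the operad of metric trees. -/
structure AInftySpace (X : Type*) [TopologicalSpace X] where
  M : ∀ n : ℕ, MetricTree n → (Fin n → X) → X
  continuous_M : ∀ n, KContinuous fun z : MetricTree n × (Fin n → X) => M n z.1 z.2
  M_one : ∀ x : Fin 1 → X, M 1 (corolla 1) x = x 0
  M_comp : ∀ {n m N : ℕ} (h : N + 1 = n + m) (i : ℕ) (hi : i < n) (ρ : MetricTree n)
    (τ : MetricTree m) (x : Fin N → X),
    M N (ρ.comp h i hi τ) x = M n ρ (contract h i hi x (M m τ (block h i hi x)))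

/-- Left `A∞`-actions of the `A∞`-space `X` on `P`. The structure map for trees with `n + 1` leaves,
the last one of which carries an element of `P`, is `act n`. -/
structure LeftAction {X : Type*} [TopologicalSpace X] (A : AInftySpace X)
    (P : Type*) [TopologicalSpace P] where
  act : ∀ n : ℕ, MetricTree (n + 1) → (Fin n → X) → P → P
  continuous_act : ∀ n,
    KContinuous fun z : MetricTree (n + 1) × (Fin n → X) × P => act n z.1 z.2.1 z.2.2
  act_one : ∀ (x : Fin 0 → X) (p : P), act 0 (corolla 1) x p = p
  act_comp : ∀ {n m N : ℕ} (h : N + 1 = n + m) (i : ℕ) (hi : i < n) (ρ : MetricTree (n + 1))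
    (τ : MetricTree m) (x : Fin N → X) (p : P),
    act N (ρ.comp (by omega) i (by omega) τ) x p =
      act n ρ (contract h i hi x (A.M m τ (block h i hi x))) p
  act_comp_last : ∀ {n m : ℕ} (ρ : MetricTree (n + 1)) (τ : MetricTree (m + 1))
    (x : Fin (n + m) → X) (p : P),
    act (n + m) (ρ.comp (by omega) n (by omega) τ) x p =
      act n ρ (fun k => x (Fin.castAdd m k)) (act m τ (fun k => x (Fin.natAdd n k)) p)

/-- Right `A∞`-actions of the `A∞`-space `X` on `Q`. The structure map for trees with `n + 1`
leaves, the first one of which carries an element of `Q`, is `act n`. -/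
structure RightAction {X : Type*} [TopologicalSpace X] (A : AInftySpace X)
    (Q : Type*) [TopologicalSpace Q] where
  act : ∀ n : ℕ, MetricTree (n + 1) → Q → (Fin n → X) → Q
  continuous_act : ∀ n,
    KContinuous fun z : MetricTree (n + 1) × Q × (Fin n → X) => act n z.1 z.2.1 z.2.2
  act_one : ∀ (q : Q) (x : Fin 0 → X), act 0 (corolla 1) q x = q
  act_comp : ∀ {n m N : ℕ} (h : N + 1 = n + m) (i : ℕ) (hi : i < n) (ρ : MetricTree (n + 1))
    (τ : MetricTree m) (q : Q) (x : Fin N → X),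
    act N (ρ.comp (by omega) (i + 1) (by omega) τ) q x =
      act n ρ q (contract h i hi x (A.M m τ (block h i hi x)))
  act_comp_first : ∀ {n m : ℕ} (ρ : MetricTree (n + 1)) (τ : MetricTree (m + 1))
    (q : Q) (x : Fin (m + n) → X),
    act (m + n) (ρ.comp (by omega) 0 (by omega) τ) q x =
      act n ρ (act m τ q (fun k => x (Fin.castAdd n k))) (fun k => x (Fin.natAdd m k))

/-- The canonical right action of an `A∞`-space on itself. -/
def AInftySpace.selfAction {X : Type*} [TopologicalSpace X] (A : AInftySpace X) :
    RightAction A X where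
  act n T q x := A.M (n + 1) T (Fin.cons q x)
  continuous_act n := by
    have h : Continuous fun z : MetricTree (n + 1) × X × (Fin n → X) =>
        (z.1, (Fin.cons z.2.1 z.2.2 : Fin (n + 1) → X)) := by
      refine continuous_fst.prodMk (continuous_pi fun j => ?_)
      refine Fin.cases ?_ (fun j => ?_) j
      · simp only [Fin.cons_zero]
        fun_prop
      · simp only [Fin.cons_succ]
        fun_prop
    exact (A.continuous_M (n + 1)).comp (CompactCoherentification.continuous_map_of_continuous h)
  act_one q x := by simp [A.M_one]
  act_comp := by
    intro n m N h i hi ρ τ q x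
    rw [A.M_comp]
    congr 1
    have hb : block (show N + 1 + 1 = n + 1 + m by omega) (i + 1) (by omega)
        (Fin.cons q x : Fin (N + 1) → X) = block h i hi x := by
      funext k
      unfold block
      have : (⟨i + 1 + k, by omega⟩ : Fin (N + 1)) = Fin.succ ⟨i + k, by omega⟩ := by
        ext; simp; omega
      rw [this, Fin.cons_succ]
    rw [hb]
    funext j
    refine Fin.cases ?_ (fun j => ?_) j
    · have : (⟨0, by omega⟩ : Fin (N + 1)) = 0 := rfl
      simp [contract]
    · rw [Fin.cons_succ]
      unfold contract
      by_cases h1 : j.1 < i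
      · rw [dif_pos (show (Fin.succ j).1 < i + 1 by simp; omega), dif_pos h1]
        have : (⟨(Fin.succ j).1, by simp; omega⟩ : Fin (N + 1)) = Fin.succ ⟨j, by omega⟩ := by
          ext; simp
        rw [this, Fin.cons_succ]
      · rw [dif_neg (show ¬ (Fin.succ j).1 < i + 1 by simp; omega), dif_neg h1]
        by_cases h2 : j.1 = i
        · rw [dif_pos (show (Fin.succ j).1 = i + 1 by simp; omega), dif_pos h2]
        · rw [dif_neg (show ¬ (Fin.succ j).1 = i + 1 by simp; omega), dif_neg h2]
          have : (⟨(Fin.succ j).1 + m - 1, by simp; omega⟩ : Fin (N + 1)) =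
              Fin.succ ⟨j + m - 1, by omega⟩ := by
            ext; simp; omega
          rw [this, Fin.cons_succ]
  act_comp_first := by
    intro n m ρ τ q x
    rw [A.M_comp]
    congr 1
    have hb : block (show m + n + 1 + 1 = n + 1 + (m + 1) by omega) 0 (by omega)
        (Fin.cons q x : Fin (m + n + 1) → X) = Fin.cons q (fun k => x (Fin.castAdd n k)) := by
      funext k
      refine Fin.cases ?_ (fun k => ?_) k
      · simp [block]
      · unfold block
        have : (⟨0 + (Fin.succ k).1, by simp; omega⟩ : Fin (m + n + 1)) =
            Fin.succ (Fin.castAdd n k) := by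
          ext; simp
        rw [this, Fin.cons_succ, Fin.cons_succ]
    rw [hb]
    funext j
    refine Fin.cases ?_ (fun j => ?_) j
    · simp [contract]
    · rw [Fin.cons_succ]
      unfold contract
      rw [dif_neg (by simp), dif_neg (by simp)]
      have : (⟨(Fin.succ j).1 + (m + 1) - 1, by simp; omega⟩ : Fin (m + n + 1)) =
          Fin.succ (Fin.natAdd m j) := by
        ext; simp; omega
      rw [this, Fin.cons_succ]

/-- The trivial right action on the one point space. -/
def AInftySpace.trivialAction {X : Type*} [TopologicalSpace X] (A : AInftySpace X) :
    RightAction A Unit where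
  act _ _ q _ := q
  continuous_act _ := by
    unfold KContinuous
    exact continuous_of_const fun _ _ => rfl
  act_one _ _ := rfl
  act_comp _ _ _ _ _ _ _ := rfl
  act_comp_first _ _ _ _ := rfl

/-! ### The two-sided bar construction -/

section Bar

variable {X : Type*} [TopologicalSpace X] {A : AInftySpace X}
  {Q : Type*} [TopologicalSpace Q] {P : Type*} [TopologicalSpace P]

/-- The disjoint union of the spaces `K (n + 2) × Q × X ^ n × P` for `n ≥ 0`. -/
abbrev PreBar (Q X P : Type*) [TopologicalSpace Q] [TopologicalSpace X] [TopologicalSpace P] :=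
  Σ n : ℕ, CompactCoherentification (MetricTree (n + 2) × Q × (Fin n → X) × P)

/-- The point `(T; q, x, p)` of the disjoint union. -/
noncomputable def PreBar.mk {n : ℕ} (T : MetricTree (n + 2)) (q : Q) (x : Fin n → X) (p : P) : PreBar Q X P :=
  ⟨n, CompactCoherentification.mk _ (T, q, x, p)⟩

/-- The identifications in the bar construction: a tree `τ` with at least one leaf which is grafted
on the first leaf, on a leaf in between, or on the last leaf of `ρ` is replaced by its value. -/
inductive BarRel (R : RightAction A Q) (L : LeftAction A P) : PreBar Q X P → PreBar Q X P → Prop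
  | first {n m : ℕ} (ρ : MetricTree (n + 2)) (τ : MetricTree (m + 1)) (q : Q)
      (x : Fin (m + n) → X) (p : P) :
      BarRel R L (PreBar.mk (ρ.comp (by omega) 0 (by omega) τ) q x p)
        (PreBar.mk ρ (R.act m τ q (fun k => x (Fin.castAdd n k))) (fun k => x (Fin.natAdd m k)) p)
  | middle {n m N : ℕ} (h : N + 1 = n + m) (hm : 1 ≤ m) (i : ℕ) (hi : i < n)
      (ρ : MetricTree (n + 2)) (τ : MetricTree m) (q : Q) (x : Fin N → X) (p : P) :
      BarRel R L (PreBar.mk (ρ.comp (by omega) (i + 1) (by omega) τ) q x p)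
        (PreBar.mk ρ q (contract h i hi x (A.M m τ (block h i hi x))) p)
  | last {n m : ℕ} (ρ : MetricTree (n + 2)) (τ : MetricTree (m + 1)) (q : Q)
      (x : Fin (n + m) → X) (p : P) :
      BarRel R L (PreBar.mk (ρ.comp (by omega) (n + 1) (by omega) τ) q x p)
        (PreBar.mk ρ q (fun k => x (Fin.castAdd m k)) (L.act m τ (fun k => x (Fin.natAdd n k)) p))

/-- The two-sided bar construction `B(Q, X, P)`. -/
def Bar (R : RightAction A Q) (L : LeftAction A P) : Type _ := Quot (BarRel R L)

instance (R : RightAction A Q) (L : LeftAction A P) : TopologicalSpace (Bar R L) :=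
  inferInstanceAs (TopologicalSpace (Quot (BarRel R L)))

/-- The class `[T; q, x, p]` in `B(Q, X, P)`. -/
noncomputable def Bar.mk (R : RightAction A Q) (L : LeftAction A P) {n : ℕ} (T : MetricTree (n + 2)) (q : Q)
    (x : Fin n → X) (p : P) : Bar R L :=
  Quot.mk _ (PreBar.mk T q x p)

end Bar

/-! ### Moore paths -/

/-- The space of Moore paths on `B`: pairs of a map `γ : [0, ∞) → B` and a length `r` such that `γ`
is constant on `[r, ∞)`, with the compactly generated topology. -/
abbrev MoorePath (B : Type*) [TopologicalSpace B] : Type _ :=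
  CompactCoherentification {γ : C(ℝ≥0, B) × ℝ≥0 // ∀ t, γ.2 ≤ t → γ.1 t = γ.1 γ.2}

namespace MoorePath

variable {B : Type*} [TopologicalSpace B]

/-- The value of a Moore path at time `t`. -/
noncomputable def eval (γ : MoorePath B) (t : ℝ≥0) : B :=
  ((CompactCoherentification.mk _).symm γ).1.1 t

/-- The length of a Moore path. -/
noncomputable def length (γ : MoorePath B) : ℝ≥0 :=
  ((CompactCoherentification.mk _).symm γ).1.2

end MoorePath

/-! ### Metric trees as length functions -/

/-! Put the base point on a new first leaf and let this leaf travel along the left spine of `T`,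
from the root up to the external edge of the leaf carrying `x`. At each moment the result is a tree
`S` with one more leaf, whose first leaf can be erased to recover `T`, and the path runs through the
points `[S; *, x, x₁, …, xₙ, p]`. At the start `S` is `T` grafted with length `1` on the last leaf
of the corolla `δ₂`, so the point is `[δ₂; *, N(T; …)]`. At the end the first leaf lies above an
edge of length `1`. Everything above that edge is absorbed by the trivial action, and the point is
`[T; *, …]`.

To parametrize this motion, `MetricTree.position` measures how far the first leaf has moved. The map
`S ↦ (S.eraseFirst, S.position)` onto `K (n + 2) × [0, 1]` is surjective
(`MetricTree.exists_eraseFirst_eq_position_eq`) and injective away from position `1`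
(`MetricTree.eq_of_position_eq`). At position `1` the class depends only on the erased tree
(`Bar.mk_eq_mk_eraseFirst`). Hence `Bar.sweep` is independent of the chosen `S` (`Bar.sweep_eq`).

Grafting on any leaf but the first commutes with erasing the first leaf and preserves the position
(`MetricTree.eraseFirst_comp`, `MetricTree.position_comp`). So each identification in `B(X, X, P)`
lifts to one in `B(*, X, P)`, and the path descends to the quotient. Continuity descends along `S ↦
(S.eraseFirst, S.position)` because this map comes from a compact Hausdorff space; with the other
factors present, one argues over compact sets and then uses the exponential law
(`continuous_of_kContinuous_comp`). -/

instance (n : ℕ) : Finite (PlanarTree n) := by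
  have hE : ∀ T : PlanarTree n, T.edges ∈ (Finset.range n ×ˢ Finset.range n).powerset := by
    intro T
    rw [Finset.mem_powerset]
    intro e he
    have := T.isEdge e he
    simp only [IsEdge] at this
    simp only [Finset.mem_product, Finset.mem_range]
    omega
  refine Finite.of_injective
    (fun T : PlanarTree n => (⟨T.edges, hE T⟩ :
      {E // E ∈ (Finset.range n ×ˢ Finset.range n).powerset})) fun T T' h => ?_
  exact PlanarTree.ext (congrArg Subtype.val h)

namespace LabeledTree

variable {n : ℕ}

lemma continuous_len : Continuous (len : LabeledTree n → ℕ × ℕ → unitInterval) := by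
  refine continuous_sigma fun S => continuous_pi fun e => ?_
  by_cases h : e ∈ S.edges
  · simpa [len, h] using continuous_apply (⟨e, h⟩ : S.edges)
  · simpa [len, h] using continuous_const

end LabeledTree

namespace MetricTree

variable {n m N : ℕ}

/-- The length of the internal edge `e`, which is `0` if there is no such edge. -/
noncomputable def len (T : MetricTree n) : ℕ × ℕ → unitInterval :=
  Quot.lift LabeledTree.len (fun _ _ => LabeledTree.len_of_collapses) T

lemma len_injective : Function.Injective (len : MetricTree n → ℕ × ℕ → unitInterval) := by
  intro T T' h
  induction T using Quot.ind
  induction T' using Quot.ind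
  exact LabeledTree.mk_eq_of_len_eq h

lemma continuous_len : Continuous (len : MetricTree n → ℕ × ℕ → unitInterval) :=
  continuous_quot_lift _ LabeledTree.continuous_len

instance : CompactSpace (MetricTree n) :=
  inferInstanceAs (CompactSpace (Quot (LabeledTree.Collapses (n := n))))

instance : T2Space (MetricTree n) := T2Space.of_injective_continuous len_injective continuous_len

/-- A continuous injection from a compact space to a Hausdorff space. It allows maps into
`MetricTree n` to be tested for continuity one edge length at a time. -/
lemma isClosedEmbedding_len :
    Topology.IsClosedEmbedding (len : MetricTree n → ℕ × ℕ → unitInterval) :=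
  continuous_len.isClosedEmbedding len_injective

lemma isEdge_of_len_ne_zero {T : MetricTree n} {e : ℕ × ℕ} (h : T.len e ≠ 0) : IsEdge n e := by
  induction T using Quot.ind with
  | mk T => exact T.1.isEdge e (by_contra fun hc => h (LabeledTree.len_eq_zero hc))

lemma len_eq_zero {T : MetricTree n} {e : ℕ × ℕ} (h : ¬ IsEdge n e) : T.len e = 0 :=
  by_contra fun hc => h (isEdge_of_len_ne_zero hc)

lemma nested_of_len_ne_zero {T : MetricTree n} {e f : ℕ × ℕ} (he : T.len e ≠ 0)
    (hf : T.len f ≠ 0) : NestedOrDisjoint e f := by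
  induction T using Quot.ind with
  | mk T =>
    exact T.1.nested e (by_contra fun hc => he (LabeledTree.len_eq_zero hc)) f
      (by_contra fun hc => hf (LabeledTree.len_eq_zero hc))

lemma len_eq_zero_of_crossing {T : MetricTree n} {e f : ℕ × ℕ} (he : T.len e ≠ 0)
    (h : ¬ NestedOrDisjoint e f) : T.len f = 0 :=
  by_contra fun hc => h (nested_of_len_ne_zero he hc)

/-- Two metric trees are equal if their internal edges have the same lengths. -/
lemma ext_len {T T' : MetricTree n} (h : ∀ e, IsEdge n e → T.len e = T'.len e) : T = T' := by
  refine len_injective (funext fun e => ?_)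
  by_cases he : IsEdge n e
  · exact h e he
  · rw [len_eq_zero he, len_eq_zero he]

/-- A function whose support consists of pairwise nested or disjoint edges is the length function
of a metric tree. -/
lemma exists_len_eq (f : ℕ × ℕ → unitInterval) (h : ∀ e, f e ≠ 0 → IsEdge n e)
    (h' : ∀ e e', f e ≠ 0 → f e' ≠ 0 → NestedOrDisjoint e e') :
    ∃ T : MetricTree n, T.len = f := by
  refine ⟨Quot.mk _ (LabeledTree.ofLen f
    ⟨(Finset.range n ×ˢ Finset.range n).filter (fun e => f e ≠ 0),
      fun e he => h e (Finset.mem_filter.mp he).2, fun e he e' he' =>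
      h' e e' (Finset.mem_filter.mp he).2 (Finset.mem_filter.mp he').2⟩), ?_⟩
  funext e
  change (LabeledTree.ofLen f _).len e = f e
  rw [LabeledTree.len_ofLen]
  split_ifs with he
  · rfl
  · by_contra hc
    have := h e (Ne.symm hc)
    simp only [IsEdge] at this
    refine he (Finset.mem_filter.mpr ⟨?_, Ne.symm hc⟩)
    simp only [Finset.mem_product, Finset.mem_range]
    omega

/-- The metric tree with a given length function. -/
noncomputable def ofLen (f : ℕ × ℕ → unitInterval) (h : ∀ e, f e ≠ 0 → IsEdge n e)
    (h' : ∀ e e', f e ≠ 0 → f e' ≠ 0 → NestedOrDisjoint e e') : MetricTree n :=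
  (exists_len_eq f h h').choose

lemma len_ofLen (f : ℕ × ℕ → unitInterval) (h : ∀ e, f e ≠ 0 → IsEdge n e)
    (h' : ∀ e e', f e ≠ 0 → f e' ≠ 0 → NestedOrDisjoint e e') : (ofLen f h h').len = f :=
  (exists_len_eq f h h').choose_spec

@[simp] lemma len_corolla (e : ℕ × ℕ) : (corolla n).len e = 0 :=
  LabeledTree.len_eq_zero (T := ⟨⟨∅, by simp, by simp⟩, fun _ => 0⟩) (by simp)

lemma len_le_sup_filter (T : MetricTree n) (g : ℕ × ℕ → ℕ × ℕ) {e J : ℕ × ℕ} (h : g e = J) :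
    T.len e ≤ ((Finset.range n ×ˢ Finset.range n).filter (fun e => g e = J)).sup T.len := by
  by_cases he : IsEdge n e
  · refine Finset.le_sup (f := T.len) (Finset.mem_filter.mpr ⟨?_, h⟩)
    simp only [IsEdge] at he
    simp only [Finset.mem_product, Finset.mem_range]
    omega
  · rw [len_eq_zero he]
    exact bot_le

/-- The lengths of the edges of a grafted tree. -/
lemma len_graft (r : unitInterval) (h : N + 1 = n + m) (hm : 1 ≤ m) (i : ℕ) (hi : i < n)
    (T : MetricTree n) (S : MetricTree m) (J : ℕ × ℕ) :
    (graft r h i hi T S).len J =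
      if IsEdge N J then
        if J = (i, i + m - 1) then r
        else if i ≤ J.1 ∧ J.2 < i + m then S.len (J.1 - i, J.2 - i)
        else if (J.1 ≤ i ∨ i + m ≤ J.1) ∧ (J.2 < i ∨ i + m ≤ J.2 + 1) then
          T.len (if J.1 ≤ i then J.1 else J.1 + 1 - m, if J.2 < i then J.2 else J.2 + 1 - m)
        else 0
      else 0 := by
  have key : (graft r h i hi T S).len J =
      if IsEdge N J then LabeledTree.graftLen n m i r T.len S.len J else 0 := by
    induction T using Quot.ind
    induction S using Quot.ind
    exact congrFun (LabeledTree.len_graft r h i hi _ _) J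
  rw [key]
  by_cases hJ : IsEdge N J
  swap
  · rw [if_neg hJ, if_neg hJ]
  rw [if_pos hJ, if_pos hJ]
  obtain ⟨c, d⟩ := J
  simp only [IsEdge] at hJ
  unfold LabeledTree.graftLen
  refine le_antisymm (sup_le (sup_le (Finset.sup_le fun e he => ?_) (Finset.sup_le fun e he => ?_))
    ?_) ?_
  · obtain ⟨a, b⟩ := e
    rw [Finset.mem_filter] at he
    have he := he.2
    by_cases hT : IsEdge n (a, b)
    swap
    · rw [len_eq_zero hT]
      exact unitInterval.nonneg'
    simp only [IsEdge] at hT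
    simp only [LabeledTree.lowerEdge, Prod.mk.injEq] at he
    obtain ⟨rfl, rfl⟩ := he
    split_ifs at * <;> simp only [Prod.mk.injEq, not_and, not_or, not_lt, not_le] at * <;>
      first
      | (exfalso; omega)
      | (apply le_of_eq; congr 2 <;> omega)
  · obtain ⟨a, b⟩ := e
    rw [Finset.mem_filter] at he
    have he := he.2
    by_cases hS : IsEdge m (a, b)
    swap
    · rw [len_eq_zero hS]
      exact unitInterval.nonneg'
    simp only [IsEdge] at hS
    simp only [LabeledTree.upperEdge, Prod.mk.injEq] at he
    obtain ⟨rfl, rfl⟩ := he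
    rw [if_neg (by simp only [Prod.mk.injEq]; omega), if_pos (by omega)]
    apply le_of_eq
    congr 2 <;> omega
  · split_ifs with h1
    · exact le_rfl
    all_goals exact unitInterval.nonneg'
  · split_ifs with h1 h2 h3
    · exact le_sup_right
    · refine le_trans (le_trans ?_ le_sup_right) le_sup_left
      refine len_le_sup_filter S _ ?_
      simp only [LabeledTree.upperEdge, Prod.mk.injEq]
      simp only at h2
      omega
    on_goal 5 => exact unitInterval.nonneg'
    all_goals
      refine le_trans (le_trans ?_ le_sup_left) le_sup_left
      refine len_le_sup_filter T _ ?_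
      simp only [Prod.mk.injEq] at *
      simp only [LabeledTree.lowerEdge, Prod.mk.injEq]
      split_ifs <;> omega

/-! ### Erasing the first leaf -/

/-- The lengths of the edges which remain after erasing the first leaf. -/
noncomputable def eraseFirstLen (S : MetricTree (n + 1)) (e : ℕ × ℕ) : unitInterval :=
  if IsEdge n e then
    if e.1 = 0 then S.len (0, e.2 + 1) ⊔ S.len (1, e.2 + 1) else S.len (e.1 + 1, e.2 + 1)
  else 0

/-- Each edge that remains comes from an edge of `S`, with or without the first leaf above it.
Nestedness of the remaining edges is inherited from `S` in this way. -/
lemma exists_of_eraseFirstLen_ne_zero {S : MetricTree (n + 1)} {e : ℕ × ℕ}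
    (h : eraseFirstLen S e ≠ 0) :
    ∃ c, S.len (c, e.2 + 1) ≠ 0 ∧ (c = e.1 + 1 ∨ c = 0 ∧ e.1 = 0) := by
  unfold eraseFirstLen at h
  split_ifs at h with h1 h2
  · by_cases h3 : S.len (0, e.2 + 1) = 0
    · refine ⟨1, fun h4 => h ?_, Or.inl (by omega)⟩
      rw [h3, h4, sup_idem]
    · exact ⟨0, h3, Or.inr ⟨rfl, h2⟩⟩
  · exact ⟨_, h, Or.inl rfl⟩
  · exact absurd rfl h

/-- The tree obtained by erasing the first leaf. -/
noncomputable def eraseFirst (S : MetricTree (n + 1)) : MetricTree n :=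
  ofLen (eraseFirstLen S) (fun e h => by_contra fun hc => h (if_neg hc)) (by
    intro e e' h h'
    obtain ⟨c, hc, hc'⟩ := exists_of_eraseFirstLen_ne_zero h
    obtain ⟨d, hd, hd'⟩ := exists_of_eraseFirstLen_ne_zero h'
    have h1 := nested_of_len_ne_zero hc hd
    have h2 := isEdge_of_len_ne_zero hc
    have h3 := isEdge_of_len_ne_zero hd
    have h4 : IsEdge n e := by_contra fun hc => h (if_neg hc)
    have h5 : IsEdge n e' := by_contra fun hc => h' (if_neg hc)
    simp only [IsEdge, NestedOrDisjoint] at *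
    omega)

lemma len_eraseFirst (S : MetricTree (n + 1)) (e : ℕ × ℕ) :
    S.eraseFirst.len e = if IsEdge n e then
      if e.1 = 0 then S.len (0, e.2 + 1) ⊔ S.len (1, e.2 + 1) else S.len (e.1 + 1, e.2 + 1)
    else 0 :=
  congrFun (len_ofLen _ _ _) e

lemma continuous_len_apply (e : ℕ × ℕ) : Continuous fun T : MetricTree n => T.len e :=
  (continuous_apply e).comp continuous_len

lemma continuous_eraseFirst : Continuous (eraseFirst : MetricTree (n + 1) → MetricTree n) := by
  rw [isClosedEmbedding_len.continuous_iff]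
  refine continuous_pi fun e => ?_
  simp only [Function.comp_apply, len_eraseFirst]
  split_ifs
  · exact (continuous_len_apply _).sup (continuous_len_apply _)
  · exact continuous_len_apply _
  · exact continuous_const

/-! ### The position of the first leaf -/

/-- The length of the edge above which exactly the first leaf and the following `m + 1` leaves
lie. -/
noncomputable def below (S : MetricTree n) (m : ℕ) : unitInterval := S.len (0, m + 1)

/-- The length of the edge above which exactly the `m + 1` leaves following the first leaf lie.
For `m = 0` this is an external edge, and we put its length to be `1`. -/
noncomputable def above (S : MetricTree n) (m : ℕ) : unitInterval :=
  if m = 0 then 1 else S.len (1, m + 1)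

lemma above_zero (S : MetricTree n) : S.above 0 = 1 := if_pos rfl

lemma above_of_ne (S : MetricTree n) (h : m ≠ 0) : S.above m = S.len (1, m + 1) := if_neg h

/-- The two sets of leaves cross: only the first contains the first leaf, and only the second
contains leaf `m + 1`. Thus the first leaf sits at a single place of the spine, and once it has
passed part of an edge, no edge nearer to the root is still above it. -/
lemma below_eq_zero_or_above_eq_zero (S : MetricTree n) {k m : ℕ} (h : k < m) :
    S.below k = 0 ∨ S.above m = 0 := by
  by_contra! hc
  rw [above_of_ne _ (by omega)] at hc
  have := nested_of_len_ne_zero hc.1 hc.2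
  simp only [NestedOrDisjoint] at this
  omega

end MetricTree

/-! ### The contribution of one spine edge to the position -/

/-- The factor which an edge of the left spine contributes to the position of the first leaf, if
it is divided into a lower part of length `a` and an upper part of length `b`. -/
def spineFactor (a b : unitInterval) : ℝ := (1 - (a : ℝ)) * (1 - (a : ℝ) * (1 - (b : ℝ)))

section SpineFactor

variable {a b a' b' : unitInterval}

lemma spineFactor_zero_left : spineFactor 0 b = 1 := by simp [spineFactor]

lemma spineFactor_one_right : spineFactor a 1 = 1 - a := by simp [spineFactor]

lemma one_sub_mul_one_sub_nonneg : 0 ≤ 1 - (a : ℝ) * (1 - (b : ℝ)) := by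
  nlinarith [a.2.1, a.2.2, b.2.1, b.2.2, mul_nonneg a.2.1 b.2.1]

lemma spineFactor_nonneg : 0 ≤ spineFactor a b :=
  mul_nonneg (by linarith [a.2.2]) one_sub_mul_one_sub_nonneg

/-- Since merged edges get the maximum of their lengths, the leaf moves up an edge of length `l`
through the splittings `(0, l)`, `(l, l)`, `(l, 0)`. The factor `1 - a` sees the first stage, and `1
- a * (1 - b)` is there to see the second. -/
lemma spineFactor_anti (ha : a ≤ a') (hb : b' ≤ b) : spineFactor a' b' ≤ spineFactor a b := by
  have ha : (a : ℝ) ≤ a' := ha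
  have hb : (b' : ℝ) ≤ b := hb
  refine mul_le_mul (by linarith) ?_ one_sub_mul_one_sub_nonneg (by linarith [a.2.2])
  have := mul_le_mul ha (by linarith : 1 - (b : ℝ) ≤ 1 - b') (by linarith [b.2.2]) a'.2.1
  linarith

lemma spineFactor_le_one : spineFactor a b ≤ 1 :=
  (spineFactor_anti (b := 1) (b' := b) (a' := a) (a := 0) unitInterval.nonneg'
    unitInterval.le_one').trans_eq spineFactor_zero_left

lemma eq_one_of_spineFactor_eq_zero (h : spineFactor a b = 0) : a = 1 := by
  have ha : (a : ℝ) = 1 := by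
    rcases mul_eq_zero.mp h with h | h
    · linarith
    · nlinarith [a.2.1, a.2.2, b.2.1, b.2.2, mul_nonneg a.2.1 b.2.1]
  exact Subtype.ext ha

/-- Strict monotonicity as long as the factor is nonzero. For `a = 0` the upper length is not seen,
but it is then determined by the total length of the edge. -/
lemma eq_of_spineFactor_eq (ha : a ≤ a') (hb : b' ≤ b) (h : spineFactor a' b' = spineFactor a b)
    (h0 : spineFactor a b ≠ 0) : a = a' ∧ (a = 0 ∨ b = b') := by
  have ha : (a : ℝ) ≤ a' := ha
  have hb : (b' : ℝ) ≤ b := hb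
  have h1 : 1 - (a' : ℝ) * (1 - b') ≤ 1 - (a : ℝ) * (1 - b) := by
    have := mul_le_mul ha (by linarith : 1 - (b : ℝ) ≤ 1 - b') (by linarith [b.2.2]) a'.2.1
    linarith
  have h2 : 0 < 1 - (a : ℝ) * (1 - b) :=
    lt_of_le_of_ne one_sub_mul_one_sub_nonneg fun hc => h0 (by simp [spineFactor, ← hc])
  have h3 : 0 < 1 - (a : ℝ) :=
    lt_of_le_of_ne (by linarith [a.2.2]) fun hc => h0 (by simp [spineFactor, ← hc])
  unfold spineFactor at h
  have h4 : (a : ℝ) = a' := by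
    by_contra hc
    have : (a : ℝ) < a' := lt_of_le_of_ne ha hc
    nlinarith [mul_le_mul_of_nonneg_left h1 (by linarith [a'.2.2] : 0 ≤ 1 - (a' : ℝ))]
  refine ⟨Subtype.ext h4, ?_⟩
  rw [← h4] at h
  have h5 := mul_left_cancel₀ h3.ne' h
  have h6 : (a : ℝ) * (b - b') = 0 := by linarith
  rcases mul_eq_zero.mp h6 with h7 | h7
  · exact Or.inl (Subtype.ext h7)
  · exact Or.inr (Subtype.ext (by linarith))

end SpineFactor

/-! ### Comparability of two positions on a spine -/

lemma unitInterval.pos_of_lt {a b : unitInterval} (h : a < b) : b ≠ 0 :=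
  (lt_of_le_of_lt unitInterval.nonneg' h).ne'

/-- Two positions of the first leaf on the same spine are comparable. -/
lemma forall_le_or_forall_le {n : ℕ} {a b a' b' : ℕ → unitInterval}
    (hmax : ∀ m, 1 ≤ m → m ≤ n → a m ⊔ b m = a' m ⊔ b' m)
    (h : ∀ k m, k < m → a k = 0 ∨ b m = 0) (h' : ∀ k m, k < m → a' k = 0 ∨ b' m = 0)
    (ha : a (n + 1) = a' (n + 1)) (hb : b 0 = b' 0) :
    (∀ m ≤ n + 1, a m ≤ a' m ∧ b' m ≤ b m) ∨ (∀ m ≤ n + 1, a' m ≤ a m ∧ b m ≤ b' m) := by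
  -- If the first position is not at or before the second one at the edge `k`, then the first has
  -- already passed part of that edge while the second still has part of it above. The external
  -- edges `0` and `n + 1` are exceptions to one half of this. Two such failures in opposite
  -- directions contradict the single-place conditions `h`, `h'` or, at the same edge, the common
  -- maximum.
  have key : ∀ a b a' b' : ℕ → unitInterval, a (n + 1) = a' (n + 1) → b 0 = b' 0 →
      (∀ m, 1 ≤ m → m ≤ n → a m ⊔ b m = a' m ⊔ b' m) → ∀ k ≤ n + 1,
      ¬ (a k ≤ a' k ∧ b' k ≤ b k) → (k ≤ n → a k ≠ 0) ∧ (1 ≤ k → b' k ≠ 0) := by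
    intro a b a' b' ha hb hmax k hk hc
    by_cases h1 : a' k < a k
    · refine ⟨fun _ => unitInterval.pos_of_lt h1, fun h2 => ?_⟩
      have h3 : k ≤ n := by
        by_contra h3
        obtain rfl : k = n + 1 := by omega
        exact h1.ne ha.symm
      have h4 := hmax k h2 h3
      have h5 : a k ≤ a' k ⊔ b' k := h4 ▸ le_sup_left
      rcases le_sup_iff.mp h5 with h6 | h6
      · exact absurd h1 h6.not_gt
      · exact unitInterval.pos_of_lt (h1.trans_le h6)
    · have h2 : b k < b' k := by
        by_contra h2
        exact hc ⟨not_lt.mp h1, not_lt.mp h2⟩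
      refine ⟨fun h3 => ?_, fun _ => unitInterval.pos_of_lt h2⟩
      have h4 : 1 ≤ k := by
        by_contra h4
        obtain rfl : k = 0 := by omega
        exact h2.ne hb
      have h5 : b' k ≤ a k ⊔ b k := (hmax k h4 h3) ▸ le_sup_right
      rcases le_sup_iff.mp h5 with h6 | h6
      · exact unitInterval.pos_of_lt (h2.trans_le h6)
      · exact absurd h2 h6.not_gt
  by_contra hc
  rw [not_or] at hc
  obtain ⟨h1, h2⟩ := hc
  push Not at h1 h2
  obtain ⟨k, hk, hk'⟩ := h1
  obtain ⟨m, hm, hm'⟩ := h2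
  have hk1 := key a b a' b' ha hb hmax k hk (by rwa [not_and, not_le])
  have hm1 := key a' b' a b ha.symm hb.symm (fun j h1 h2 => (hmax j h1 h2).symm) m hm
    (by rwa [not_and, not_le])
  rcases lt_trichotomy k m with hl | rfl | hl
  · rcases h k m hl with h3 | h3
    · exact hk1.1 (by omega) h3
    · exact hm1.2 (by omega) h3
  · have h3 : (a k < a' k ∧ b k < b' k) ∨ (a' k < a k ∧ b' k < b k) := by
      by_cases h3 : a k ≤ a' k
      · exact Or.inl ⟨not_le.mp fun h4 => absurd (hm' h4) (hk' h3).not_gt, hk' h3⟩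
      · exact Or.inr ⟨not_le.mp h3, hm' (not_le.mp h3).le⟩
    have hkn : k ≤ n := by
      by_contra h6
      obtain rfl : k = n + 1 := by omega
      exact h3.elim (fun h4 => h4.1.ne ha) (fun h4 => h4.1.ne ha.symm)
    have hk0 : 1 ≤ k := by
      by_contra h6
      obtain rfl : k = 0 := by omega
      exact h3.elim (fun h4 => h4.2.ne hb) (fun h4 => h4.2.ne hb.symm)
    exact h3.elim (fun h4 => (max_lt_max h4.1 h4.2).ne (hmax k hk0 hkn))
      (fun h4 => (max_lt_max h4.1 h4.2).ne (hmax k hk0 hkn).symm)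
  · rcases h' m k hl with h3 | h3
    · exact hm1.1 (by omega) h3
    · exact hk1.2 (by omega) h3

/-! ### The position of the first leaf and its fibers -/

namespace MetricTree

variable {n m N : ℕ}

/-- The part of the position of the first leaf that depends on the edges below and above it. -/
noncomputable def spineProd (S : MetricTree (n + 3)) : ℝ :=
  ∏ m ∈ Finset.range (n + 1), spineFactor (S.below m) (S.above m)

lemma spineProd_nonneg (S : MetricTree (n + 3)) : 0 ≤ S.spineProd :=
  Finset.prod_nonneg fun _ _ => spineFactor_nonneg

lemma spineProd_le_one (S : MetricTree (n + 3)) : S.spineProd ≤ 1 :=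
  Finset.prod_le_one (fun _ _ => spineFactor_nonneg) fun _ _ => spineFactor_le_one

lemma spineProd_eq_one (S : MetricTree (n + 3)) (h : ∀ m ≤ n, S.below m = 0) :
    S.spineProd = 1 :=
  Finset.prod_eq_one fun m hm => by
    rw [h m (by have := Finset.mem_range.mp hm; omega), spineFactor_zero_left]

/-- The position of the first leaf on the spine of the tree that remains when it is erased. It moves
from `0`, where the first leaf lies below all other vertices at distance `1`, to `1`, where it lies
above an edge of length `1`. -/
noncomputable def position (S : MetricTree (n + 3)) : unitInterval :=
  ⟨(1 - (S.above (n + 1) : ℝ) + (1 - S.spineProd)) / 2, by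
    by_cases h : S.above (n + 1) = 0
    · rw [h, Set.Icc.coe_zero]
      constructor <;> linarith [S.spineProd_nonneg, S.spineProd_le_one]
    · rw [S.spineProd_eq_one fun m hm =>
        (S.below_eq_zero_or_above_eq_zero (by omega)).resolve_right h]
      constructor <;> linarith [(S.above (n + 1)).2.1, (S.above (n + 1)).2.2]⟩

lemma coe_position (S : MetricTree (n + 3)) :
    (S.position : ℝ) = (1 - (S.above (n + 1) : ℝ) + (1 - S.spineProd)) / 2 := rfl

lemma continuous_position : Continuous (position : MetricTree (n + 3) → unitInterval) := by
  refine Continuous.subtype_mk ?_ _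
  have h1 : ∀ m, Continuous fun S : MetricTree (n + 3) => (S.below m : ℝ) := fun m =>
    continuous_subtype_val.comp (continuous_len_apply _)
  have h2 : ∀ m, Continuous fun S : MetricTree (n + 3) => (S.above m : ℝ) := fun m => by
    refine continuous_subtype_val.comp ?_
    unfold above
    split_ifs
    · exact continuous_const
    · exact continuous_len_apply _
  have h3 : Continuous (spineProd : MetricTree (n + 3) → ℝ) := by
    unfold spineProd spineFactor
    fun_prop
  fun_prop

lemma exists_below_eq_one {S : MetricTree (n + 3)} (h : S.spineProd = 0) :
    ∃ m ≤ n, S.below m = 1 := by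
  obtain ⟨m, hm, h⟩ := Finset.prod_eq_zero_iff.mp h
  exact ⟨m, by have := Finset.mem_range.mp hm; omega, eq_one_of_spineFactor_eq_zero h⟩

lemma spineProd_eq_zero_of_position_eq_one {S : MetricTree (n + 3)} (h : S.position = 1) :
    S.spineProd = 0 := by
  have h1 := S.coe_position
  rw [h, Set.Icc.coe_one] at h1
  linarith [S.spineProd_nonneg, (S.above (n + 1)).2.1]

/-- A vanishing product gives an edge of length `1` below the first leaf. This forces `S.above (n +
1) = 0`, so both summands of the position are maximal. -/
lemma spineProd_ne_zero_of_position_ne_one {S : MetricTree (n + 3)} (h : S.position ≠ 1) :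
    S.spineProd ≠ 0 := by
  intro h0
  obtain ⟨m, hm, h1⟩ := exists_below_eq_one h0
  have h2 : S.above (n + 1) = 0 :=
    (S.below_eq_zero_or_above_eq_zero (k := m) (by omega)).resolve_left (by simp [h1])
  refine h (Subtype.ext ?_)
  rw [coe_position, h0, h2]
  norm_num

lemma below_sup_above {S : MetricTree (n + 3)} (h1 : 1 ≤ m) (hn : m ≤ n) :
    S.below m ⊔ S.above m = S.eraseFirst.len (0, m) := by
  rw [len_eraseFirst, if_pos (by simp only [IsEdge]; omega), if_pos rfl, above_of_ne _ (by omega)]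
  rfl

/-- Erasing the first leaf only merges edges starting at leaf `0` or `1`; all other edges can be
read off from the erased tree. -/
lemma eq_of_below_eq_of_above_eq {S S' : MetricTree (n + 3)} (h : S.eraseFirst = S'.eraseFirst)
    (ha : ∀ m ≤ n, S.below m = S'.below m)
    (hb : ∀ m, 1 ≤ m → m ≤ n + 1 → S.above m = S'.above m) : S = S' := by
  refine ext_len fun e he => ?_
  obtain ⟨c, d⟩ := e
  simp only [IsEdge] at he
  obtain ⟨d, rfl⟩ : ∃ k, d = k + 1 := ⟨d - 1, by omega⟩
  match c, he with
  | 0, he => exact ha d (by omega)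
  | 1, he =>
    have := hb d (by omega) (by omega)
    rwa [above_of_ne _ (by omega), above_of_ne _ (by omega)] at this
  | c + 2, he =>
    have := congrArg (fun T => len T (c + 1, d)) h
    simpa [len_eraseFirst, show IsEdge (n + 2) (c + 1, d) by simp only [IsEdge]; omega] using this

/-- The two trees are comparable along the spine, and the position is strictly monotone along it
until it reaches `1`. -/
lemma eq_of_position_eq {S S' : MetricTree (n + 3)} (h : S.eraseFirst = S'.eraseFirst)
    (hp : S.position = S'.position) (h1 : S.position ≠ 1) : S = S' := by
  have key : ∀ S S' : MetricTree (n + 3), S.eraseFirst = S'.eraseFirst →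
      S.position = S'.position → S.position ≠ 1 →
      (∀ m ≤ n + 1, S.below m ≤ S'.below m ∧ S'.above m ≤ S.above m) → S = S' := by
    intro S S' h hp h1 hle
    have h0 := spineProd_ne_zero_of_position_ne_one h1
    have h0' := spineProd_ne_zero_of_position_ne_one (hp ▸ h1)
    have hf : ∀ m ∈ Finset.range (n + 1), spineFactor (S'.below m) (S'.above m) ≤
        spineFactor (S.below m) (S.above m) := fun m hm => by
      have := hle m (by have := Finset.mem_range.mp hm; omega)
      exact spineFactor_anti this.1 this.2
    have hprod : S'.spineProd ≤ S.spineProd :=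
      Finset.prod_le_prod (fun _ _ => spineFactor_nonneg) hf
    have htop : (S'.above (n + 1) : ℝ) ≤ S.above (n + 1) := (hle (n + 1) le_rfl).2
    have hp' : (S.position : ℝ) = S'.position := by rw [hp]
    rw [coe_position, coe_position] at hp'
    -- Both summands of the position change in the same direction, and all factors are positive. A
    -- strict inequality in a single factor would therefore make the positions differ.
    have hfe : ∀ m ≤ n, spineFactor (S'.below m) (S'.above m) =
        spineFactor (S.below m) (S.above m) := by
      intro m hm
      have hm : m ∈ Finset.range (n + 1) := Finset.mem_range.mpr (by omega)
      by_contra hc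
      have : S'.spineProd < S.spineProd := Finset.prod_lt_prod
        (fun k hk => lt_of_le_of_ne spineFactor_nonneg
          (Ne.symm (Finset.prod_ne_zero_iff.mp h0' k hk))) hf
        ⟨m, hm, lt_of_le_of_ne (hf m hm) hc⟩
      linarith
    have heq : ∀ m ≤ n, S.below m = S'.below m ∧ (S.below m = 0 ∨ S.above m = S'.above m) :=
      fun m hm => eq_of_spineFactor_eq (hle m (by omega)).1 (hle m (by omega)).2 (hfe m hm)
        (Finset.prod_ne_zero_iff.mp h0 m (Finset.mem_range.mpr (by omega)))
    refine eq_of_below_eq_of_above_eq h (fun m hm => (heq m hm).1) fun m hm hm' => ?_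
    rcases eq_or_lt_of_le hm' with rfl | hm'
    · exact Subtype.ext (by linarith)
    · obtain ⟨h2, h3⟩ := heq m (by omega)
      rcases h3 with h3 | h3
      · have h4 := below_sup_above (S := S) hm (by omega)
        rw [h, ← below_sup_above hm (by omega), ← h2, h3] at h4
        have h5 : ∀ a : unitInterval, 0 ⊔ a = a := fun a => sup_eq_right.mpr unitInterval.nonneg'
        rwa [h5, h5] at h4
      · exact h3
  -- The pair `(0, n + 2)` consists of all leaves, so it is the root and not an internal edge.
  have hz : ∀ S : MetricTree (n + 3), S.below (n + 1) = 0 := fun S =>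
    len_eq_zero (by simp only [IsEdge]; omega)
  rcases forall_le_or_forall_le (n := n) (a := S.below) (b := S.above) (a' := S'.below)
    (b' := S'.above) (fun m h1 h2 => by rw [below_sup_above h1 h2, below_sup_above h1 h2, h])
    (fun k m => S.below_eq_zero_or_above_eq_zero) (fun k m => S'.below_eq_zero_or_above_eq_zero)
    ((hz S).trans (hz S').symm) (S.above_zero.trans S'.above_zero.symm) with h2 | h2
  · exact key S S' h hp h1 h2
  · exact (key S' S h.symm hp.symm (hp ▸ h1) h2).symm

end MetricTree

/-! ### Every position is attained -/

/-- Moving along an edge of length `l` takes every value between the two extremal ones. -/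
lemma exists_spineFactor_eq (l : unitInterval) {v : ℝ} (h1 : spineFactor l 0 ≤ v) (h2 : v ≤ 1) :
    ∃ a b : unitInterval, a ⊔ b = l ∧ spineFactor a b = v := by
  have hle : ∀ s : unitInterval, l * s ≤ l := fun s => unitInterval.mul_le_left
  -- The splitting `(l, l)` is the corner of the path from `(0, l)` to `(l, 0)`; the intermediate
  -- value theorem applies on either side of it.
  rcases le_total (spineFactor l l) v with h | h
  · obtain ⟨s, hs⟩ := mem_range_of_exists_le_of_exists_ge
      (f := fun s : unitInterval => spineFactor (l * s) l) (c := v)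
      (by unfold spineFactor; fun_prop) ⟨1, by simpa using h⟩
      ⟨0, by simpa [spineFactor_zero_left] using h2⟩
    exact ⟨l * s, l, sup_eq_right.mpr (hle s), hs⟩
  · obtain ⟨s, hs⟩ := mem_range_of_exists_le_of_exists_ge
      (f := fun s : unitInterval => spineFactor l (l * s)) (c := v)
      (by unfold spineFactor; fun_prop) ⟨0, by simpa using h1⟩ ⟨1, by simpa using h⟩
    exact ⟨l, l * s, sup_eq_left.mpr (hle s), hs⟩

namespace MetricTree

variable {n m N : ℕ}

/-- A new first leaf can be attached on the edge `(0, j)` of `T`, where `(0, 0)` stands for the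
external edge at the first leaf and `(0, n + 1)` for the one at the root. -/
lemma exists_attach (T : MetricTree (n + 2)) (j : ℕ) (hj : j ≤ n + 1) (a b : unitInterval)
    (hab : 1 ≤ j → j ≤ n → a ⊔ b = T.len (0, j)) :
    ∃ S : MetricTree (n + 3), S.eraseFirst = T ∧
      (∀ m, j < m → m ≤ n → S.below m = T.len (0, m)) ∧ (∀ m, j < m → S.above m = 0) ∧
      (j ≤ n → S.below j = a) ∧ (1 ≤ j → S.above j = b) ∧ (∀ m, m < j → S.below m = 0) := by
  let L : ℕ × ℕ → unitInterval := fun e => if IsEdge (n + 3) e then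
      if e.1 = 0 then
        if j + 1 < e.2 then T.len (0, e.2 - 1) else if e.2 = j + 1 then a else 0
      else if e.1 = 1 then
        if e.2 < j + 1 then T.len (0, e.2 - 1) else if e.2 = j + 1 then b else 0
      else T.len (e.1 - 1, e.2 - 1)
    else 0
  have hz : ∀ a b : unitInterval, a ⊔ b = 0 → a = 0 ∧ b = 0 := fun a b h =>
    ⟨le_antisymm (h ▸ le_sup_left) unitInterval.nonneg',
      le_antisymm (h ▸ le_sup_right) unitInterval.nonneg'⟩
  have hL1 : ∀ e, L e ≠ 0 → IsEdge (n + 3) e := fun e h => by_contra fun hc => h (if_neg hc)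
  -- A nonzero entry lies over an edge of `T`, on the correct side of the point of attachment. The
  -- only exceptions are the new edges that arise from attaching on an external edge: `(0, 1)` for
  -- `j = 0` and `(1, n + 2)` for `j = n + 1`.
  have hL : ∀ e, L e ≠ 0 → T.len (e.1 - 1, e.2 - 1) ≠ 0 ∧ (e.1 = 0 → j + 1 ≤ e.2) ∧
      (e.1 = 1 → e.2 ≤ j + 1) ∨ (e.1 = 0 ∧ e.2 = 1 ∧ j = 0) ∨
      (e.1 = 1 ∧ e.2 = n + 2 ∧ j = n + 1) := by
    intro e he
    have h1 := hL1 e he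
    have hab' : 1 ≤ j → j ≤ n → T.len (0, j) = 0 → a = 0 ∧ b = 0 := fun h1 h2 h3 =>
      hz _ _ ((hab h1 h2).trans h3)
    obtain ⟨c, d⟩ := e
    simp only [IsEdge] at h1
    by_cases hT : T.len (c - 1, d - 1) = 0
    · right
      have hc : c = 0 ∨ c = 1 ∨ 2 ≤ c := by omega
      simp only [L, IsEdge, h1, and_self, if_true] at he
      rcases hc with rfl | rfl | hc
      · have h2 : d = j + 1 := by
          by_contra h2
          simp_all
        subst h2
        by_contra h3
        have := (hab' (by omega) (by omega) (by simpa using hT)).1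
        simp_all
      · have h2 : d = j + 1 := by
          by_contra h2
          simp_all
        subst h2
        by_contra h3
        have := (hab' (by omega) (by omega) (by simpa using hT)).2
        simp_all
      · exact absurd hT (by simpa [show c ≠ 0 by omega, show c ≠ 1 by omega] using he)
    · refine Or.inl ⟨hT, ?_, ?_⟩
      · rintro h2
        by_contra h3
        simp only at h2 h3
        refine he ?_
        simp only [L, h2, if_true]
        simp [show ¬ j + 1 < d by omega, show d ≠ j + 1 by omega]
      · rintro h2
        by_contra h3
        simp only at h2 h3
        refine he ?_
        simp only [L, h2, if_true]
        simp [show ¬ d < j + 1 by omega, show d ≠ j + 1 by omega]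
  obtain ⟨S, hS⟩ := exists_len_eq L hL1 (by
    intro e f he hf
    have h1 := hL1 e he
    have h2 := hL1 f hf
    rcases hL e he with h3 | h3 <;> rcases hL f hf with h4 | h4
    · have h5 := nested_of_len_ne_zero h3.1 h4.1
      have h6 := isEdge_of_len_ne_zero h3.1
      have h7 := isEdge_of_len_ne_zero h4.1
      simp only [IsEdge, NestedOrDisjoint] at *
      omega
    · have h6 := isEdge_of_len_ne_zero h3.1
      simp only [IsEdge, NestedOrDisjoint] at *
      omega
    · have h6 := isEdge_of_len_ne_zero h4.1
      simp only [IsEdge, NestedOrDisjoint] at *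
      omega
    · simp only [IsEdge, NestedOrDisjoint] at *
      omega)
  have hbelow : ∀ m ≤ n, S.below m =
      if j < m then T.len (0, m) else if m = j then a else 0 := by
    intro m hm
    simp [below, hS, L, show IsEdge (n + 3) (0, m + 1) by simp only [IsEdge]; omega]
  have habove : ∀ m, 1 ≤ m → S.above m = if m ≤ n + 1 then
      if m < j then T.len (0, m) else if m = j then b else 0 else 0 := by
    intro m hm
    rw [above_of_ne _ (by omega), hS]
    by_cases h : m ≤ n + 1
    · simp [L, show IsEdge (n + 3) (1, m + 1) by simp only [IsEdge]; omega, h]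
    · simp [L, show ¬ IsEdge (n + 3) (1, m + 1) by simp only [IsEdge]; omega, h]
  refine ⟨S, ?_, ?_, ?_, ?_, ?_, ?_⟩
  · refine ext_len fun e he => ?_
    obtain ⟨c, d⟩ := e
    have he' := he
    simp only [IsEdge] at he'
    rw [len_eraseFirst, if_pos he]
    have h0 : ∀ x : unitInterval, x ⊔ 0 = x ∧ 0 ⊔ x = x := fun x =>
      ⟨sup_eq_left.mpr unitInterval.nonneg', sup_eq_right.mpr unitInterval.nonneg'⟩
    by_cases hc : c = 0
    · subst hc
      have h1 := hbelow d (by omega)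
      have h2 := habove d (by omega)
      rw [above_of_ne _ (by omega), if_pos (by omega)] at h2
      rw [below] at h1
      simp only [if_true, h1, h2]
      rcases lt_trichotomy j d with h3 | rfl | h3
      · rw [if_pos h3, if_neg (by omega), if_neg (by omega), (h0 _).1]
      · simpa using hab (by omega) (by omega)
      · rw [if_neg (by omega), if_neg (by omega), if_pos h3, (h0 _).2]
    · simp [hS, L, hc, show IsEdge (n + 3) (c + 1, d + 1) by simp only [IsEdge]; omega]
  · intro m h1 h2
    rw [hbelow m h2, if_pos h1]
  · intro m h1
    simp [habove m (by omega), show ¬ m < j by omega, show m ≠ j by omega]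
  · intro h
    rw [hbelow j h, if_neg (by omega), if_pos rfl]
  · intro h
    rw [habove j h, if_pos hj, if_neg (by omega), if_pos rfl]
  · intro m h
    rw [hbelow m (by omega), if_neg (by omega), if_neg (by omega)]

/-- Spine edges not yet reached contribute `1`, and those already passed contribute the factor of
the splitting `(l, 0)`. Only the edge `j` is variable. -/
lemma spineProd_eq_of_attached {T : MetricTree (n + 2)} {S : MetricTree (n + 3)} {j : ℕ}
    (hj : j ≤ n) (h1 : ∀ m, j < m → m ≤ n → S.below m = T.len (0, m))
    (h2 : ∀ m, j < m → S.above m = 0) (h3 : ∀ m, m < j → S.below m = 0) :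
    S.spineProd = spineFactor (S.below j) (S.above j) *
      ∏ m ∈ Finset.Ioc j n, spineFactor (T.len (0, m)) 0 := by
  have h4 : ∏ m ∈ Finset.Ioc j n, spineFactor (T.len (0, m)) 0 =
      ∏ m ∈ Finset.Ioc j n, spineFactor (S.below m) (S.above m) := by
    refine Finset.prod_congr rfl fun m hm => ?_
    rw [Finset.mem_Ioc] at hm
    rw [h1 m hm.1 hm.2, h2 m hm.1]
  rw [h4, ← Finset.prod_insert (f := fun m => spineFactor (S.below m) (S.above m)) (by simp),
    Finset.Ioc_insert_left hj]
  symm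
  refine Finset.prod_subset (fun m hm => ?_) fun m hm hm' => ?_
  · rw [Finset.mem_Icc] at hm
    exact Finset.mem_range.mpr (by omega)
  · rw [Finset.mem_range] at hm
    rw [Finset.mem_Icc] at hm'
    rw [h3 m (by omega), spineFactor_zero_left]

/-- Over each tree, every position is attained. -/
lemma exists_eraseFirst_eq_position_eq (T : MetricTree (n + 2)) (t : unitInterval) :
    ∃ S : MetricTree (n + 3), S.eraseFirst = T ∧ S.position = t := by
  rcases le_total (t : ℝ) (1 / 2) with ht | ht
  -- During the first half the leaf is attached at the root, and the edge above it of length `b`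
  -- gives the position `(1 - b) / 2`.
  · obtain ⟨S, hS, -, -, -, h1, h2⟩ := exists_attach T (n + 1) le_rfl 0
      ⟨1 - 2 * t, by linarith, by linarith [t.2.1]⟩ (fun _ h => by omega)
    refine ⟨S, hS, Subtype.ext ?_⟩
    rw [coe_position, h1 (by omega), S.spineProd_eq_one fun m hm => h2 m (by omega)]
    simp only
    ring
  -- During the second half `spineProd` has to be `2 - 2 * t`. Here `Q j` is its value when the leaf
  -- has just passed all edges nearer to the root than `j`; the least `j` with `2 - 2 * t ≤ Q j` is
  -- the edge on which the leaf must be attached.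
  · let Q : ℕ → ℝ := fun j => ∏ m ∈ Finset.Ioc j n, spineFactor (T.len (0, m)) 0
    have hQ0 : ∀ j, 0 ≤ Q j := fun j => Finset.prod_nonneg fun _ _ => spineFactor_nonneg
    have hex : ∃ j, 2 - 2 * (t : ℝ) ≤ Q j := ⟨n, by simp [Q]; linarith⟩
    have hQ : ∃ j ≤ n, 2 - 2 * (t : ℝ) ≤ Q j ∧ (j ≠ 0 → Q (j - 1) < 2 - 2 * (t : ℝ)) :=
      ⟨Nat.find hex, Nat.find_min' hex (by simp [Q]; linarith), Nat.find_spec hex,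
        fun h => not_le.mp (Nat.find_min hex (by omega))⟩
    obtain ⟨j, hjn, h1, h2⟩ := hQ
    have hfin : ∀ S : MetricTree (n + 3), S.eraseFirst = T → S.above (n + 1) = 0 →
        S.spineProd = 2 - 2 * (t : ℝ) → ∃ S : MetricTree (n + 3), S.eraseFirst = T ∧
        S.position = t := by
      intro S hS h3 h4
      refine ⟨S, hS, Subtype.ext ?_⟩
      rw [coe_position, h3, h4, Set.Icc.coe_zero]
      ring
    have ht' : 0 ≤ 2 - 2 * (t : ℝ) := by linarith [t.2.2]
    rcases Nat.eq_zero_or_pos j with rfl | hj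
    · obtain ⟨S, hS, h3, h4, h5, -, h6⟩ := exists_attach T 0 (by omega)
        ⟨1 - (2 - 2 * t) / Q 0, by
          linarith [div_le_one_of_le₀ h1 (hQ0 0)], by linarith [div_nonneg ht' (hQ0 0)]⟩ 0
        (fun h _ => by omega)
      refine hfin S hS (h4 _ (by omega)) ?_
      rw [spineProd_eq_of_attached (T := T) hjn h3 h4 h6, h5 hjn, above_zero,
        spineFactor_one_right]
      change (1 - (1 - (2 - 2 * (t : ℝ)) / Q 0)) * Q 0 = _
      -- If `Q 0 = 0`, the required product is `0` as well, and any splitting serves.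
      rcases eq_or_lt_of_le (hQ0 0) with h | h
      · rw [← h] at h1 ⊢
        linarith
      · field_simp
        ring
    · have h2 := h2 hj.ne'
      have h3 : Q (j - 1) = spineFactor (T.len (0, j)) 0 * Q j := by
        have : Finset.Ioc (j - 1) n = insert j (Finset.Ioc j n) := by
          ext k
          simp only [Finset.mem_Ioc, Finset.mem_insert]
          omega
        simp only [Q]
        rw [this, Finset.prod_insert (by simp)]
      have hQj : 0 < Q j := by
        refine lt_of_le_of_ne (hQ0 j) fun h => ?_
        rw [h3, ← h, mul_zero] at h2
        rw [← h] at h1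
        linarith
      obtain ⟨a, b, hab, h4⟩ := exists_spineFactor_eq (T.len (0, j)) (v := (2 - 2 * t) / Q j)
        (by rw [le_div_iff₀ hQj, ← h3]; exact h2.le) (div_le_one_of_le₀ h1 hQj.le)
      obtain ⟨S, hS, h5, h6, h7, h8, h9⟩ := exists_attach T j (by omega) a b fun _ _ => hab
      refine hfin S hS (h6 _ (by omega)) ?_
      rw [spineProd_eq_of_attached (T := T) hjn h5 h6 h9, h7 hjn, h8 hj, h4]
      exact div_mul_cancel₀ _ hQj.ne'

/-! ### Grafting on leaves other than the first -/

lemma len_graft_new (r : unitInterval) (h : N + 1 = n + m) (hm : 1 ≤ m) (i : ℕ) (hi : i < n)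
    (T : MetricTree n) (S : MetricTree m) {p q : ℕ} (hJ : IsEdge N (p, q)) (h1 : p = i)
    (h2 : q + 1 = i + m) : (graft r h i hi T S).len (p, q) = r := by
  rw [len_graft r h hm, if_pos hJ, if_pos (Prod.ext h1 (by simp only; omega))]

lemma len_graft_upper (r : unitInterval) (h : N + 1 = n + m) (hm : 1 ≤ m) (i : ℕ) (hi : i < n)
    (T : MetricTree n) (S : MetricTree m) {p q : ℕ} (hJ : IsEdge N (p, q)) (h1 : i ≤ p)
    (h2 : q < i + m) (h3 : ¬ (p = i ∧ q + 1 = i + m)) :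
    (graft r h i hi T S).len (p, q) = S.len (p - i, q - i) := by
  rw [len_graft r h hm, if_pos hJ, if_neg (by rw [Prod.mk.injEq]; omega), if_pos ⟨h1, h2⟩]

lemma len_graft_lower (r : unitInterval) (h : N + 1 = n + m) (hm : 1 ≤ m) (i : ℕ) (hi : i < n)
    (T : MetricTree n) (S : MetricTree m) {p q : ℕ} (hJ : IsEdge N (p, q)) (c d : ℕ)
    (h1 : p < i ∨ i + m ≤ q ∨ q < i) (hc : p = c ∧ c ≤ i ∨ p + 1 = c + m ∧ i < c)
    (hd : q = d ∧ d < i ∨ q + 1 = d + m ∧ i ≤ d) :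
    (graft r h i hi T S).len (p, q) = T.len (c, d) := by
  have hJ' := hJ
  simp only [IsEdge] at hJ'
  rw [len_graft r h hm, if_pos hJ, if_neg (by rw [Prod.mk.injEq]; omega),
    if_neg (by simp only; omega), if_pos (by simp only; omega)]
  congr 2 <;> simp only <;> split_ifs <;> omega

lemma len_graft_crossing (r : unitInterval) (h : N + 1 = n + m) (hm : 1 ≤ m) (i : ℕ) (hi : i < n)
    (T : MetricTree n) (S : MetricTree m) {p q : ℕ}
    (h1 : (i < p ∧ p < i + m ∧ i + m ≤ q) ∨ (p < i ∧ i ≤ q ∧ q + 1 < i + m)) :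
    (graft r h i hi T S).len (p, q) = 0 := by
  rw [len_graft r h hm]
  by_cases hJ : IsEdge N (p, q)
  · rw [if_pos hJ, if_neg (by rw [Prod.mk.injEq]; omega), if_neg (by simp only; omega),
      if_neg (by simp only; omega)]
  · rw [if_neg hJ]

/-- The delicate case is grafting on the second leaf: erasing the first leaf may merge the new edge
with another one. The maximum is still `1` because the new edge has the largest possible length. -/
lemma eraseFirst_comp (h : N + 1 = n + m) (hm : 1 ≤ m) (i : ℕ) (hi : i < n)
    (S : MetricTree (n + 1)) (τ : MetricTree m) (h' : N + 1 + 1 = n + 1 + m) (hi' : i + 1 < n + 1) :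
    (comp h' (i + 1) hi' S τ).eraseFirst = comp h i hi S.eraseFirst τ := by
  refine ext_len fun e he => ?_
  obtain ⟨c, d⟩ := e
  have he' := he
  simp only [IsEdge] at he'
  have h0 : ∀ x : unitInterval, x ⊔ 1 = 1 ∧ 0 ⊔ x = x := fun x =>
    ⟨sup_eq_right.mpr unitInterval.le_one', sup_eq_right.mpr unitInterval.nonneg'⟩
  rw [len_eraseFirst, if_pos he]
  unfold comp
  by_cases hc : c = 0
  · subst hc
    have e0 : IsEdge (N + 1) (0, d + 1) := by simp only [IsEdge]; omega
    have e1 : IsEdge (N + 1) (1, d + 1) := by simp only [IsEdge]; omega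
    rw [if_pos rfl]
    by_cases hu : i = 0 ∧ d < m
    · obtain ⟨rfl, hd⟩ := hu
      by_cases hd' : d + 1 = m
      · rw [len_graft_new 1 h hm 0 hi _ _ he rfl (by omega),
          len_graft_new 1 h' hm _ hi' _ _ e1 rfl (by omega), (h0 _).1]
      · rw [len_graft_upper 1 h hm 0 hi _ _ he (by simp) (by omega)
            (by omega),
          len_graft_upper 1 h' hm _ hi' _ _ e1 (by simp) (by omega)
            (by omega),
          len_graft_crossing 1 h' hm _ hi' _ _ (by omega), (h0 _).2]
        simp
    · by_cases hx : i ≤ d ∧ d + 1 < i + m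
      · rw [len_graft_crossing 1 h hm i hi _ _ (by omega),
          len_graft_crossing 1 h' hm _ hi' _ _ (by omega),
          len_graft_crossing 1 h' hm _ hi' _ _ (by omega), (h0 _).2]
      · obtain ⟨k, hk⟩ : ∃ k, d = k ∧ k < i ∨ d + 1 = k + m ∧ i ≤ k := by
          by_cases d < i
          · exact ⟨d, by omega⟩
          · exact ⟨d + 1 - m, by omega⟩
        rw [len_graft_lower 1 h hm i hi _ _ he 0 k (by omega) (by simp) hk,
          len_graft_lower 1 h' hm _ hi' _ _ e0 0 (k + 1) (by omega) (by simp)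
            (by omega),
          len_graft_lower 1 h' hm _ hi' _ _ e1 1 (k + 1) (by omega)
            (by omega) (by omega), len_eraseFirst,
          if_pos (by simp only [IsEdge]; omega), if_pos rfl]
  · have e1 : IsEdge (N + 1) (c + 1, d + 1) := by simp only [IsEdge]; omega
    rw [if_neg hc]
    by_cases hu : i ≤ c ∧ d < i + m
    · by_cases hd' : c = i ∧ d + 1 = i + m
      · rw [len_graft_new 1 h hm i hi _ _ he hd'.1 hd'.2,
          len_graft_new 1 h' hm _ hi' _ _ e1 (by omega) (by omega)]
      · rw [len_graft_upper 1 h hm i hi _ _ he hu.1 hu.2 hd',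
          len_graft_upper 1 h' hm _ hi' _ _ e1 (by omega) (by omega)
            (by omega)]
        congr 2 <;> omega
    · by_cases hx : (i < c ∧ c < i + m ∧ i + m ≤ d) ∨ (c < i ∧ i ≤ d ∧ d + 1 < i + m)
      · rw [len_graft_crossing 1 h hm i hi _ _ hx,
          len_graft_crossing 1 h' hm _ hi' _ _ (by omega)]
      · obtain ⟨k, hk⟩ : ∃ k, d = k ∧ k < i ∨ d + 1 = k + m ∧ i ≤ k := by
          by_cases d < i
          · exact ⟨d, by omega⟩
          · exact ⟨d + 1 - m, by omega⟩
        obtain ⟨l, hl⟩ : ∃ l, c = l ∧ l ≤ i ∨ c + 1 = l + m ∧ i < l := by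
          by_cases c ≤ i
          · exact ⟨c, by omega⟩
          · exact ⟨c + 1 - m, by omega⟩
        rw [len_graft_lower 1 h hm i hi _ _ he l k (by omega) hl hk,
          len_graft_lower 1 h' hm _ hi' _ _ e1 (l + 1) (k + 1) (by omega)
            (by omega) (by omega), len_eraseFirst]
        by_cases hlk : IsEdge n (l, k)
        · rw [if_pos hlk, if_neg (by simp only; omega)]
        · rw [if_neg hlk]
          refine len_eq_zero fun hc => hlk ?_
          simp only [IsEdge] at hc ⊢
          omega

lemma above_last_comp (h : N + 3 + 1 = n + 3 + m) (hm : 1 ≤ m) (i : ℕ) (hi : i + 1 < n + 3)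
    (S : MetricTree (n + 3)) (τ : MetricTree m) :
    (comp h (i + 1) hi S τ).above (N + 1) = S.above (n + 1) := by
  rw [above_of_ne _ (by omega), above_of_ne _ (by omega)]
  exact len_graft_lower 1 h hm _ hi _ _ (by simp only [IsEdge]; omega) _ _ (by omega)
    (by omega) (by omega)

lemma spineFactor_comp_of_lt (h : N + 3 + 1 = n + 3 + m) (hm : 1 ≤ m) (i : ℕ) (hi : i + 1 < n + 3)
    (S : MetricTree (n + 3)) (τ : MetricTree m)
    {k : ℕ} (hk : k < i) (hn : k ≤ n) :
    spineFactor ((comp h (i + 1) hi S τ).below k) ((comp h (i + 1) hi S τ).above k) =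
      spineFactor (S.below k) (S.above k) := by
  have h1 : (comp h (i + 1) hi S τ).below k = S.below k :=
    len_graft_lower 1 h hm _ hi _ _ (by simp only [IsEdge]; omega) _ _ (by omega)
      (by omega) (by omega)
  have h2 : (comp h (i + 1) hi S τ).above k = S.above k := by
    rcases Nat.eq_zero_or_pos k with rfl | hk0
    · rw [above_zero, above_zero]
    · rw [above_of_ne _ (by omega), above_of_ne _ (by omega)]
      exact len_graft_lower 1 h hm _ hi _ _ (by simp only [IsEdge]; omega) _ _
        (by omega) (by omega) (by omega)
  rw [h1, h2]

lemma spineFactor_comp_of_crossing (h : N + 3 + 1 = n + 3 + m) (hm : 1 ≤ m) (i : ℕ) (hi : i + 1 < n + 3)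
    (S : MetricTree (n + 3)) (τ : MetricTree m)
    {k : ℕ} (hk : i ≤ k) (hk' : k + 1 < i + m) :
    spineFactor ((comp h (i + 1) hi S τ).below k) ((comp h (i + 1) hi S τ).above k) = 1 := by
  have h1 : (comp h (i + 1) hi S τ).below k = 0 :=
    len_graft_crossing 1 h hm _ hi _ _ (by omega)
  rw [h1, spineFactor_zero_left]

/-- For `k = 0` the external edge at the second leaf may become the new internal edge of length `1`.
This is why `above` has the value `1` at `0`. -/
lemma spineFactor_comp_of_le (h : N + 3 + 1 = n + 3 + m) (hm : 1 ≤ m) (i : ℕ) (hi : i + 1 < n + 3)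
    (S : MetricTree (n + 3)) (τ : MetricTree m)
    {k : ℕ} (hk : i ≤ k) (hn : k ≤ n) :
    spineFactor ((comp h (i + 1) hi S τ).below (k + (m - 1)))
      ((comp h (i + 1) hi S τ).above (k + (m - 1))) = spineFactor (S.below k) (S.above k) := by
  have h1 : (comp h (i + 1) hi S τ).below (k + (m - 1)) = S.below k :=
    len_graft_lower 1 h hm _ hi _ _ (by simp only [IsEdge]; omega) _ _ (by omega)
      (by omega) (by omega)
  have h2 : (comp h (i + 1) hi S τ).above (k + (m - 1)) = S.above k := by
    rcases Nat.eq_zero_or_pos k with rfl | hk0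
    · obtain rfl : i = 0 := by omega
      rw [above_zero]
      rcases Nat.eq_zero_or_pos (m - 1) with h0 | h0
      · rw [h0, above_zero]
      · rw [above_of_ne _ (by omega)]
        exact len_graft_new 1 h hm _ hi _ _ (by simp only [IsEdge]; omega) rfl
          (by omega)
    · rw [above_of_ne _ (by omega), above_of_ne _ (by omega)]
      exact len_graft_lower 1 h hm _ hi _ _ (by simp only [IsEdge]; omega) _ _
        (by omega) (by omega) (by omega)
  rw [h1, h2]

/-- The indices of `S` from `i` on are shifted by `m - 1`. The `m - 1` indices inserted there belong
to edges that would separate leaves of `τ`, and contribute `1`. -/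
lemma spineProd_comp (h : N + 3 + 1 = n + 3 + m) (hm : 1 ≤ m) (i : ℕ) (hi : i + 1 < n + 3)
    (S : MetricTree (n + 3)) (τ : MetricTree m) :
    (comp h (i + 1) hi S τ).spineProd = S.spineProd := by
  obtain ⟨q, hq⟩ : ∃ q, n + 1 = i + q := ⟨n + 1 - i, by omega⟩
  have hq' : N + 1 = i + (m - 1) + q := by omega
  unfold spineProd
  rw [hq, hq', Finset.prod_range_add, Finset.prod_range_add, Finset.prod_range_add _ i q]
  have h1 : ∀ k ∈ Finset.range (m - 1), spineFactor ((comp h (i + 1) hi S τ).below (i + k))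
      ((comp h (i + 1) hi S τ).above (i + k)) = 1 := fun k hk => by
    rw [Finset.mem_range] at hk
    exact spineFactor_comp_of_crossing h hm i hi S τ (by omega) (by omega)
  rw [Finset.prod_eq_one h1, mul_one]
  congr 1
  · refine Finset.prod_congr rfl fun k hk => ?_
    rw [Finset.mem_range] at hk
    exact spineFactor_comp_of_lt h hm i hi S τ hk (by omega)
  · refine Finset.prod_congr rfl fun k hk => ?_
    rw [Finset.mem_range] at hk
    rw [show i + (m - 1) + k = i + k + (m - 1) by omega]
    exact spineFactor_comp_of_le h hm i hi S τ (by omega) (by omega)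

lemma position_comp (h : N + 3 + 1 = n + 3 + m) (hm : 1 ≤ m) (i : ℕ) (hi : i + 1 < n + 3)
    (S : MetricTree (n + 3)) (τ : MetricTree m) :
    (comp h (i + 1) hi S τ).position = S.position := by
  refine Subtype.ext ?_
  rw [coe_position, coe_position, spineProd_comp h hm, above_last_comp h hm]

end MetricTree

/-! ### Cutting a tree at a spine edge of length 1 -/

namespace MetricTree

variable {n k p : ℕ}

/-- If the first `k + 1` leaves are exactly those above some edge of `T`, this is the part of `T`
below that edge. -/
lemma exists_cutLower (T : MetricTree n) (k p : ℕ) :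
    ∃ ρ : MetricTree (p + 2), ∀ c d, IsEdge (p + 2) (c, d) →
      ρ.len (c, d) = T.len (if c = 0 then 0 else c + k, d + k) := by
  obtain ⟨ρ, hρ⟩ := exists_len_eq (n := p + 2)
    (fun e => if IsEdge (p + 2) e then T.len (if e.1 = 0 then 0 else e.1 + k, e.2 + k) else 0)
    (fun e he => by_contra fun hc => he (if_neg hc)) (by
      intro e f he hf
      have h1 : IsEdge (p + 2) e := by_contra fun hc => he (if_neg hc)
      have h2 : IsEdge (p + 2) f := by_contra fun hc => hf (if_neg hc)
      rw [if_pos h1] at he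
      rw [if_pos h2] at hf
      have h3 := nested_of_len_ne_zero he hf
      simp only [IsEdge, NestedOrDisjoint] at *
      split_ifs at h3 <;> omega)
  exact ⟨ρ, fun c d hcd => by
    rw [hρ]
    exact if_pos hcd⟩

/-- An edge of length `1` is exactly what a composition creates; for `k = 0` the upper part is the
identity `corolla 1`. The lower part is an argument, so that two different trees can be shown to
have the same lower part. -/
lemma exists_eq_comp_cutLower (T : MetricTree (n + 2)) (h : n = k + p)
    (hk : k = 0 ∨ T.len (0, k) = 1) (ρ : MetricTree (p + 2))
    (hρ : ∀ c d, IsEdge (p + 2) (c, d) → ρ.len (c, d) = T.len (if c = 0 then 0 else c + k, d + k)) :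
    ∃ τ : MetricTree (k + 1), T = ρ.comp (by omega) 0 (by omega) τ := by
  obtain ⟨τ, hτ⟩ := exists_len_eq (n := k + 1)
    (fun e => if IsEdge (k + 1) e then T.len e else 0)
    (fun e he => by_contra fun hc => he (if_neg hc)) (by
      intro e f he hf
      refine nested_of_len_ne_zero (T := T) (fun hc => he ?_) (fun hc => hf ?_)
      · simp only [hc, ite_self]
      · simp only [hc, ite_self])
  refine ⟨τ, ext_len fun e he => ?_⟩
  obtain ⟨c, d⟩ := e
  have he' := he
  simp only [IsEdge] at he'
  unfold comp
  by_cases hd : d < k + 1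
  · by_cases hn : c = 0 ∧ d = k
    · rw [len_graft_new _ _ (by omega) _ _ _ _ he (by omega) (by omega)]
      obtain ⟨rfl, rfl⟩ := hn
      exact hk.resolve_left (by omega)
    · rw [len_graft_upper _ _ (by omega) _ _ _ _ he (by omega) (by omega) (by omega), hτ]
      exact (if_pos (show IsEdge (k + 1) (c, d) by simp only [IsEdge]; omega)).symm
  · by_cases hc : 0 < c ∧ c < k + 1
    · rw [len_graft_crossing _ _ (by omega) _ _ _ _ (by omega)]
      have h1 : T.len (0, k) ≠ 0 := by
        rw [hk.resolve_left (by omega)]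
        exact one_ne_zero
      exact len_eq_zero_of_crossing h1 (by simp only [NestedOrDisjoint]; omega)
    · rw [len_graft_lower _ _ (by omega) _ _ _ _ he (c - k) (d - k) (by omega) (by omega)
        (by omega), hρ _ _ (by simp only [IsEdge]; omega)]
      congr 2
      · split_ifs <;> omega
      · omega

end MetricTree

/-! ### Blocks and contractions of tuples with an additional first entry -/

section Tuples

variable {X : Type*} {n m N : ℕ} (x : X) (xs : Fin N → X)

lemma cons_apply (k : Fin (N + 1)) :
    (Fin.cons x xs : Fin (N + 1) → X) k =
      if h : k.1 = 0 then x else xs ⟨k.1 - 1, by omega⟩ := by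
  refine Fin.cases ?_ (fun k => ?_) k <;> simp

lemma block_cons (h : N + 1 = n + m) (i : ℕ) (hi : i < n) (h' : N + 1 + 1 = n + 1 + m)
    (hi' : i + 1 < n + 1) :
    block h' (i + 1) hi' (Fin.cons x xs : Fin (N + 1) → X) = block h i hi xs := by
  funext k
  unfold block
  rw [cons_apply, dif_neg (by simp only; omega)]
  congr 2
  simp only
  omega

lemma contract_cons (h : N + 1 = n + m) (i : ℕ) (hi : i < n) (h' : N + 1 + 1 = n + 1 + m)
    (hi' : i + 1 < n + 1) (z : X) :
    contract h' (i + 1) hi' (Fin.cons x xs : Fin (N + 1) → X) z =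
      Fin.cons x (contract h i hi xs z) := by
  funext k
  simp only [contract, cons_apply]
  split_ifs <;> first | rfl | (exfalso; omega) | (congr 2; omega)

lemma block_zero_cons (h : N = m + n) (h' : N + 1 + 1 = n + 1 + (m + 1)) (hi : 0 < n + 1) :
    block h' 0 hi (Fin.cons x xs : Fin (N + 1) → X) =
      Fin.cons x fun k : Fin m => xs ⟨k, by omega⟩ := by
  funext k
  simp only [block, cons_apply]
  split_ifs <;> first | rfl | (exfalso; omega) | (congr 2; omega)

lemma contract_zero_cons (h : N = m + n) (h' : N + 1 + 1 = n + 1 + (m + 1)) (hi : 0 < n + 1)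
    (z : X) :
    contract h' 0 hi (Fin.cons x xs : Fin (N + 1) → X) z =
      Fin.cons z fun k : Fin n => xs ⟨m + k, by omega⟩ := by
  funext k
  simp only [contract, cons_apply]
  split_ifs <;> first | rfl | (exfalso; omega) | (congr 2; omega)

lemma cons_initial (h : N + 1 = n + 1 + m) :
    (fun k : Fin (n + 1) => (Fin.cons x xs : Fin (N + 1) → X) ⟨k, by omega⟩) =
      Fin.cons x fun k : Fin n => xs ⟨k, by omega⟩ := by
  funext k
  simp only [cons_apply]

end Tuples

/-! ### The sweep and its compatibility with the identifications -/

namespace Bar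

variable {X : Type*} [TopologicalSpace X] {A : AInftySpace X}
  {Q : Type*} [TopologicalSpace Q] {P : Type*} [TopologicalSpace P]
  (R : RightAction A Q) (L : LeftAction A P) {n m N : ℕ}

lemma mk_comp_first (h : N = m + n) (ρ : MetricTree (n + 2)) (τ : MetricTree (m + 1)) (q : Q)
    (x : Fin N → X) (p : P) :
    Bar.mk R L (ρ.comp (N := N + 2) (by omega) 0 (by omega) τ) q x p =
      Bar.mk R L ρ (R.act m τ q fun k => x ⟨k, by omega⟩) (fun k => x ⟨m + k, by omega⟩) p := by
  subst h
  exact Quot.sound (BarRel.first ρ τ q x p)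

lemma mk_comp_middle (h : N + 1 = n + m) (hm : 1 ≤ m) (i : ℕ) (hi : i < n)
    (ρ : MetricTree (n + 2)) (τ : MetricTree m) (q : Q) (x : Fin N → X) (p : P) :
    Bar.mk R L (ρ.comp (N := N + 2) (by omega) (i + 1) (by omega) τ) q x p =
      Bar.mk R L ρ q (contract h i hi x (A.M m τ (block h i hi x))) p :=
  Quot.sound (BarRel.middle h hm i hi ρ τ q x p)

lemma mk_comp_last (h : N = n + m) (ρ : MetricTree (n + 2)) (τ : MetricTree (m + 1)) (q : Q)
    (x : Fin N → X) (p : P) :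
    Bar.mk R L (ρ.comp (N := N + 2) (by omega) (n + 1) (by omega) τ) q x p =
      Bar.mk R L ρ q (fun k => x ⟨k, by omega⟩) (L.act m τ (fun k => x ⟨n + k, by omega⟩) p) := by
  subst h
  exact Quot.sound (BarRel.last ρ τ q x p)

/-- If the first leaf lies above an edge of length `1`, it can be moved upwards without changing the
point of `B(*, X, P)`. -/
lemma mk_eq_mk_eraseFirst {S : MetricTree (n + 3)} (hS : S.position = 1) (x : X) (xs : Fin n → X)
    (p : P) :
    Bar.mk A.trivialAction L S () (Fin.cons x xs : Fin (n + 1) → X) p =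
      Bar.mk A.trivialAction L S.eraseFirst () xs p := by
  obtain ⟨j, hj, h1⟩ :=
    MetricTree.exists_below_eq_one (MetricTree.spineProd_eq_zero_of_position_eq_one hS)
  obtain ⟨l, hl⟩ : ∃ l, n = j + l := ⟨n - j, by omega⟩
  have hl' : n + 1 = j + 1 + l := by omega
  obtain ⟨ρ, hρ⟩ := MetricTree.exists_cutLower S.eraseFirst j l
  have hlen : S.len (0, j + 1) ≠ 0 := by
    rw [show S.len (0, j + 1) = 1 from h1]
    exact one_ne_zero
  -- Cutting `S` at `(0, j + 1)` and `S.eraseFirst` at `(0, j)` leaves the same lower tree `ρ`: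
  -- edges that start at the second leaf and reach beyond the cut cross it, so they have length `0`.
  -- The trivial action forgets both upper parts.
  obtain ⟨σ, hσ⟩ := S.exists_eq_comp_cutLower hl' (Or.inr h1) ρ (by
    intro c d hcd
    have hcd' := hcd
    simp only [IsEdge] at hcd'
    rw [hρ c d hcd, MetricTree.len_eraseFirst]
    by_cases hc : c = 0
    · subst hc
      simp only [if_true]
      rw [if_pos (by simp only [IsEdge]; omega), MetricTree.len_eq_zero_of_crossing
        (e := (0, j + 1)) (f := (1, d + j + 1)) hlen (by simp only [NestedOrDisjoint]; omega)]
      exact sup_eq_left.mpr unitInterval.nonneg'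
    · rw [if_pos (by simp only [IsEdge]; split_ifs; omega)]
      simp only [hc, if_false]
      rw [if_neg (by omega)]
      rfl)
  obtain ⟨τ, hτ⟩ := S.eraseFirst.exists_eq_comp_cutLower hl (by
    rcases Nat.eq_zero_or_pos j with h0 | h0
    · exact Or.inl h0
    · right
      rw [← MetricTree.below_sup_above h0 hj, h1]
      exact sup_eq_left.mpr unitInterval.le_one') ρ hρ
  have e1 := mk_comp_first A.trivialAction L hl' ρ σ () (Fin.cons x xs : Fin (n + 1) → X) p
  have e2 := mk_comp_first A.trivialAction L hl ρ τ () xs p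
  rw [← hσ] at e1
  rw [← hτ] at e2
  rw [e1, e2]
  congr 1
  funext k
  have : (⟨j + 1 + k, by omega⟩ : Fin (n + 1)) = Fin.succ ⟨j + k, by omega⟩ := by
    ext
    simp only [Fin.val_succ]
    omega
  rw [this, Fin.cons_succ]

/-- The point of `B(*, X, P)` which is reached at time `t`, when the first leaf, which carries the
base point, moves along the spine of `T`. -/
noncomputable def sweep (T : MetricTree (n + 2)) (x : X) (xs : Fin n → X) (p : P)
    (t : unitInterval) : Bar A.trivialAction L :=
  Bar.mk A.trivialAction L (MetricTree.exists_eraseFirst_eq_position_eq T t).choose ()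
    (Fin.cons x xs : Fin (n + 1) → X) p

/-- Independence of the choice in `sweep`: away from position `1` the tree is unique, and at
position `1` its class depends only on the erased tree. -/
lemma sweep_eq (S : MetricTree (n + 3)) (x : X) (xs : Fin n → X) (p : P) :
    sweep L S.eraseFirst x xs p S.position =
      Bar.mk A.trivialAction L S () (Fin.cons x xs : Fin (n + 1) → X) p := by
  obtain ⟨h1, h2⟩ :=
    (MetricTree.exists_eraseFirst_eq_position_eq S.eraseFirst S.position).choose_spec
  unfold sweep
  by_cases h : S.position = 1
  · rw [mk_eq_mk_eraseFirst L h, mk_eq_mk_eraseFirst L (h2.trans h), h1]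
  · rw [MetricTree.eq_of_position_eq h1 h2 fun hc => h (h2.symm.trans hc)]

lemma sweep_eq_of_eq {S : MetricTree (n + 3)} {T : MetricTree (n + 2)} {t : unitInterval}
    (hT : S.eraseFirst = T) (ht : (S.position : ℝ) = t) (x : X) (xs : Fin n → X) (p : P) :
    sweep L T x xs p t = Bar.mk A.trivialAction L S () (Fin.cons x xs : Fin (n + 1) → X) p := by
  rw [← hT, ← Subtype.ext ht, sweep_eq]

lemma sweep_one (T : MetricTree (n + 2)) (x : X) (xs : Fin n → X) (p : P) :
    sweep L T x xs p 1 = Bar.mk A.trivialAction L T () xs p := by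
  obtain ⟨S, rfl, h⟩ := MetricTree.exists_eraseFirst_eq_position_eq T 1
  rw [← h, sweep_eq, mk_eq_mk_eraseFirst L h]

/-- If `S` lies over `ρ` at position `t`, then `S` with `τ` grafted one leaf further right lies over
the grafted tree at the same position. -/
lemma sweep_comp_middle (h : N + 1 = n + m) (hm : 1 ≤ m) (i : ℕ) (hi : i < n)
    (ρ : MetricTree (n + 2)) (τ : MetricTree m) (x : X) (xs : Fin N → X) (p : P)
    (t : unitInterval) :
    sweep L (ρ.comp (N := N + 2) (by omega) (i + 1) (by omega) τ) x xs p t =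
      sweep L ρ x (contract h i hi xs (A.M m τ (block h i hi xs))) p t := by
  obtain ⟨S, rfl, rfl⟩ := MetricTree.exists_eraseFirst_eq_position_eq ρ t
  have h' : N + 3 + 1 = n + 3 + m := by omega
  rw [← MetricTree.eraseFirst_comp _ hm _ _ S τ h' (by omega),
    ← MetricTree.position_comp h' hm (i + 1) (by omega) S τ, sweep_eq,
    MetricTree.position_comp h' (by omega), sweep_eq,
    mk_comp_middle A.trivialAction L (by omega) hm (i + 1) (by omega)]
  rw [block_cons x xs h i hi, contract_cons x xs h i hi]

/-- The base point occupies the leaf before `x`, so an identification on the first leaf of `ρ`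
becomes one on a middle leaf of `S`. The self-action on `x` is then the multiplication of `A`. -/
lemma sweep_comp_first (h : N = m + n) (ρ : MetricTree (n + 2)) (τ : MetricTree (m + 1)) (x : X)
    (xs : Fin N → X) (p : P) (t : unitInterval) :
    sweep L (ρ.comp (N := N + 2) (by omega) 0 (by omega) τ) x xs p t =
      sweep L ρ (A.selfAction.act m τ x fun k => xs ⟨k, by omega⟩)
        (fun k => xs ⟨m + k, by omega⟩) p t := by
  obtain ⟨S, rfl, rfl⟩ := MetricTree.exists_eraseFirst_eq_position_eq ρ t
  have h' : N + 3 + 1 = n + 3 + (m + 1) := by omega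
  rw [← MetricTree.eraseFirst_comp _ (by omega) _ _ S τ h' (by omega),
    ← MetricTree.position_comp h' (by omega) 0 (by omega) S τ, sweep_eq,
    MetricTree.position_comp h' (by omega), sweep_eq,
    mk_comp_middle A.trivialAction L (by omega) (by omega) 0 (by omega)]
  rw [block_zero_cons x xs h, contract_zero_cons x xs h]
  rfl

lemma sweep_comp_last (h : N = n + m) (ρ : MetricTree (n + 2)) (τ : MetricTree (m + 1)) (x : X)
    (xs : Fin N → X) (p : P) (t : unitInterval) :
    sweep L (ρ.comp (N := N + 2) (by omega) (n + 1) (by omega) τ) x xs p t =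
      sweep L ρ x (fun k => xs ⟨k, by omega⟩)
        (L.act m τ (fun k => xs ⟨n + k, by omega⟩) p) t := by
  obtain ⟨S, rfl, rfl⟩ := MetricTree.exists_eraseFirst_eq_position_eq ρ t
  have h' : N + 3 + 1 = n + 3 + (m + 1) := by omega
  rw [← MetricTree.eraseFirst_comp _ (by omega) _ _ S τ h' (by omega),
    ← MetricTree.position_comp h' (by omega) (n + 1) (by omega) S τ, sweep_eq,
    MetricTree.position_comp h' (by omega), sweep_eq,
    mk_comp_last A.trivialAction L (by omega)]
  rw [cons_initial x xs (show N + 1 = n + 1 + m by omega)]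
  congr 2
  funext k
  rw [cons_apply, dif_neg (by simp only; omega)]
  congr 2
  simp only
  omega

end Bar

/-! ### Descent of continuity for compactly generated topologies -/

section KSpaces

variable {A A' B I : Type*} [TopologicalSpace A] [TopologicalSpace A'] [TopologicalSpace B]
  [TopologicalSpace I]

/-- A continuous map on a `k`-space remains continuous for the compactly generated topology on the
codomain. -/
lemma Continuous.mk_compactCoherentification [CompactlyCoherentSpace A] {f : A → B}
    (hf : Continuous f) : Continuous fun a => CompactCoherentification.mk B (f a) :=
  (CompactCoherentification.continuous_map_of_continuous hf).comp
    CompactCoherentification.continuous_mk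

/-- Descent of continuity along a surjection onto `A × I` with compact preimages of compact sets,
where `A` carries the compactly generated topology. -/
lemma continuous_of_kContinuous_comp [T2Space A] [T2Space I] [CompactSpace I]
    {f : A' → A × I} (hf : Continuous f) (hs : Function.Surjective f)
    (hc : ∀ K : Set A, IsCompact K → IsCompact (f ⁻¹' (K ×ˢ Set.univ)))
    {G : A × I → B} (hG : KContinuous (G ∘ f)) :
    Continuous fun y : CompactCoherentification A × I =>
      G ((CompactCoherentification.mk A).symm y.1, y.2) := by
  have key : ∀ K : Set A, IsCompact K → Continuous fun y : K × I => G (y.1, y.2) := by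
    intro K hK
    have hC := hc K hK
    let C := f ⁻¹' (K ×ˢ Set.univ)
    have : CompactSpace C := isCompact_iff_compactSpace.mp hC
    let g : C → K × I := fun c => (⟨(f c.1).1, c.2.1⟩, (f c.1).2)
    have hg : Continuous g :=
      ((continuous_fst.comp (hf.comp continuous_subtype_val)).subtype_mk _).prodMk
        (continuous_snd.comp (hf.comp continuous_subtype_val))
    have hgs : Function.Surjective g := by
      rintro ⟨⟨a, ha⟩, t⟩
      obtain ⟨z, hz⟩ := hs (a, t)
      have hzK : z ∈ f ⁻¹' (K ×ˢ Set.univ) := by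
        rw [Set.mem_preimage, hz]
        exact ⟨ha, trivial⟩
      refine ⟨⟨z, hzK⟩, Prod.ext (Subtype.ext ?_) ?_⟩
      · change (f z).1 = a
        rw [hz]
      · change (f z).2 = t
        rw [hz]
    rw [(hg.isClosedMap.isQuotientMap hg hgs).continuous_iff]
    have h1 := CompactCoherentification.continuous_dom_iff.mp hG C hC
    exact continuousOn_iff_continuous_domRestrict.mp h1
  have hslice : ∀ a : A, Continuous fun t : I => G (a, t) := fun a =>
    (key {a} isCompact_singleton).comp
      ((continuous_const (y := (⟨a, rfl⟩ : ({a} : Set A)))).prodMk continuous_id)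
  -- After currying, the domain is the compactly generated space alone, where continuity may be
  -- tested on compact sets. Uncurrying is possible because `I` is compact Hausdorff, hence locally
  -- compact.
  let Φ : CompactCoherentification A → C(I, B) := fun a => ⟨_, hslice ((CompactCoherentification.mk A).symm a)⟩
  have hΦ : Continuous Φ := by
    rw [CompactCoherentification.continuous_dom_iff]
    intro K hK
    rw [continuousOn_iff_continuous_domRestrict]
    exact ContinuousMap.continuous_of_continuous_uncurry _ (key K hK)
  exact ContinuousMap.continuous_uncurry_of_continuous ⟨Φ, hΦ⟩

end KSpaces

/-! ### The resulting Moore paths -/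

/-- The retraction of `[0, ∞)` onto `[0, 1]`. -/
noncomputable def truncate (t : ℝ≥0) : unitInterval := Set.projIcc 0 1 zero_le_one (t : ℝ)

lemma continuous_truncate : Continuous truncate :=
  continuous_projIcc.comp NNReal.continuous_coe

lemma truncate_of_one_le {t : ℝ≥0} (h : 1 ≤ t) : truncate t = 1 :=
  Set.projIcc_of_right_le _ (by exact_mod_cast h)

lemma coe_truncate {t : ℝ≥0} (h : t ≤ 1) : (truncate t : ℝ) = t := by
  have h : (t : ℝ) ≤ 1 := by exact_mod_cast h
  simp [truncate, Set.coe_projIcc, h]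

namespace Bar

variable {X : Type*} [TopologicalSpace X] {A : AInftySpace X}
  {P : Type*} [TopologicalSpace P] (L : LeftAction A P)

lemma kContinuous_mk {Q : Type*} [TopologicalSpace Q] (R : RightAction A Q) (n : ℕ) :
    KContinuous fun z : MetricTree (n + 2) × Q × (Fin n → X) × P =>
      Bar.mk R L z.1 z.2.1 z.2.2.1 z.2.2.2 :=
  continuous_quot_mk.comp (continuous_sigmaMk (σ := fun n : ℕ =>
    CompactCoherentification (MetricTree (n + 2) × Q × (Fin n → X) × P)))

/-- Pulled back along `S ↦ (S.eraseFirst, S.position)`, the sweep is the class map of the bar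
construction. Preimages of compact sets are compact because `MetricTree (n + 3)` is compact. -/
lemma continuous_sweep [T2Space X] [T2Space P] (n : ℕ) :
    Continuous fun y : CompactCoherentification (MetricTree (n + 2) × X × (Fin n → X) × P) ×
        unitInterval =>
      sweep L ((CompactCoherentification.mk _).symm y.1).1
        ((CompactCoherentification.mk _).symm y.1).2.1
        ((CompactCoherentification.mk _).symm y.1).2.2.1
        ((CompactCoherentification.mk _).symm y.1).2.2.2 y.2 := by
  let f : MetricTree (n + 3) × X × (Fin n → X) × P →
      (MetricTree (n + 2) × X × (Fin n → X) × P) × unitInterval :=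
    fun z => ((z.1.eraseFirst, z.2), z.1.position)
  have hf : Continuous f :=
    ((MetricTree.continuous_eraseFirst.comp continuous_fst).prodMk continuous_snd).prodMk
      (MetricTree.continuous_position.comp continuous_fst)
  refine continuous_of_kContinuous_comp (f := f)
    (G := fun y => sweep L y.1.1 y.1.2.1 y.1.2.2.1 y.1.2.2.2 y.2) hf ?_ ?_ ?_
  · rintro ⟨⟨T, w⟩, t⟩
    obtain ⟨S, rfl, rfl⟩ := MetricTree.exists_eraseFirst_eq_position_eq T t
    exact ⟨(S, w), rfl⟩
  · intro K hK
    refine IsCompact.of_isClosed_subset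
      ((isCompact_univ (X := MetricTree (n + 3))).prod (hK.image continuous_snd))
      ((hK.isClosed.prod isClosed_univ).preimage hf) ?_
    rintro ⟨S, w⟩ h
    exact ⟨trivial, _, h.1, rfl⟩
  · have h1 : Continuous fun z : MetricTree (n + 3) × X × (Fin n → X) × P =>
        (z.1, (), (Fin.cons z.2.1 z.2.2.1 : Fin (n + 1) → X), z.2.2.2) := by
      refine continuous_fst.prodMk (continuous_const.prodMk (Continuous.prodMk ?_ (by fun_prop)))
      refine continuous_pi fun j => ?_
      refine Fin.cases ?_ (fun j => ?_) j
      · simp only [Fin.cons_zero]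
        fun_prop
      · simp only [Fin.cons_succ]
        fun_prop
    have h2 := (kContinuous_mk L A.trivialAction (n + 1)).comp
      (CompactCoherentification.continuous_map_of_continuous h1)
    have h3 : ((fun y => sweep L y.1.1 y.1.2.1 y.1.2.2.1 y.1.2.2.2 y.2) ∘ f) =
        fun z : MetricTree (n + 3) × X × (Fin n → X) × P => Bar.mk A.trivialAction L z.1 ()
          (Fin.cons z.2.1 z.2.2.1 : Fin (n + 1) → X) z.2.2.2 :=
      funext fun z => sweep_eq L z.1 _ _ _
    rw [h3]
    exact h2

/-- The path in `B(*, X, P)` that is swept out by moving the first leaf along the spine. -/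
noncomputable def sweepPath [T2Space X] [T2Space P] (z : PreBar X X P) :
    {γ : C(ℝ≥0, Bar A.trivialAction L) × ℝ≥0 // ∀ t, γ.2 ≤ t → γ.1 t = γ.1 γ.2} :=
  ⟨(⟨fun t : ℝ≥0 =>
    sweep L ((CompactCoherentification.mk _).symm z.2).1
      ((CompactCoherentification.mk _).symm z.2).2.1
      ((CompactCoherentification.mk _).symm z.2).2.2.1
      ((CompactCoherentification.mk _).symm z.2).2.2.2 (truncate t),
    (continuous_sweep L z.1).comp (continuous_const.prodMk continuous_truncate)⟩, 1), by
    intro t ht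
    have ht : (1 : ℝ≥0) ≤ t := ht
    simp only [ContinuousMap.coe_mk, truncate_of_one_le ht, truncate_of_one_le le_rfl]⟩

lemma continuous_sweepPath [T2Space X] [T2Space P] (n : ℕ) :
    Continuous fun z : CompactCoherentification (MetricTree (n + 2) × X × (Fin n → X) × P) =>
      sweepPath L (⟨n, z⟩ : PreBar X X P) := by
  refine Continuous.subtype_mk (Continuous.prodMk ?_ continuous_const) _
  refine ContinuousMap.continuous_of_continuous_uncurry _ ?_
  exact (continuous_sweep L n).comp (continuous_fst.prodMk
    (continuous_truncate.comp continuous_snd))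

lemma sweepPath_eq_of_barRel [T2Space X] [T2Space P] {z z' : PreBar X X P}
    (h : BarRel A.selfAction L z z') : sweepPath L z = sweepPath L z' := by
  refine Subtype.ext (Prod.ext (ContinuousMap.ext fun t => ?_) rfl)
  cases h with
  | first ρ τ q x p => exact sweep_comp_first L rfl ρ τ q x p _
  | middle h hm i hi ρ τ q x p => exact sweep_comp_middle L h hm i hi ρ τ q x p _
  | last ρ τ q x p => exact sweep_comp_last L rfl ρ τ q x p _

end Bar

/-! ### Explicit positions for the endpoints and the smallest trees -/

namespace MetricTree

variable {n : ℕ}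

lemma eq_of_two_leaves (T T' : MetricTree 2) : T = T' :=
  ext_len fun e he => by
    simp only [IsEdge] at he
    omega

lemma spineProd_of_three_leaves (S : MetricTree (0 + 3)) :
    S.spineProd = 1 - (S.len (0, 1) : ℝ) := by
  simp [spineProd, above_zero, spineFactor_one_right, below]

lemma eraseFirst_and_position_graft_corolla (h : n + 3 + 1 = 2 + (n + 2)) (hi : 1 < 2)
    (T : MetricTree (n + 2)) (r : unitInterval) :
    (graft r h 1 hi (corolla 2) T).eraseFirst = T ∧
      ((graft r h 1 hi (corolla 2) T).position : ℝ) =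
        (1 - (r : ℝ)) / 2 := by
  constructor
  · refine ext_len fun e he => ?_
    obtain ⟨c, d⟩ := e
    have he' := he
    simp only [IsEdge] at he'
    rw [len_eraseFirst, if_pos he]
    by_cases hc : c = 0
    · subst hc
      rw [if_pos rfl, len_graft_crossing _ _ (by omega) _ _ _ _ (by omega),
        len_graft_upper _ _ (by omega) _ _ _ _ (by simp only [IsEdge]; omega) (by omega)
        (by omega) (by omega)]
      exact sup_eq_right.mpr unitInterval.nonneg'
    · rw [if_neg hc, len_graft_upper _ _ (by omega) _ _ _ _ (by simp only [IsEdge]; omega)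
        (by omega) (by omega) (by omega)]
      rfl
  · have h1 : ∀ m ≤ n, (graft r h 1 hi (corolla 2) T).below m = 0 :=
      fun m hm => len_graft_crossing _ _ (by omega) _ _ _ _ (by omega)
    rw [coe_position, spineProd_eq_one _ h1, above_of_ne _ (by omega),
      len_graft_new _ _ (by omega) _ _ _ _ (by simp only [IsEdge]; omega) rfl (by omega)]
    ring

lemma position_graft_corolla_first (h : 0 + 3 + 1 = 2 + 2) (hi : 0 < 2) (r : unitInterval) :
    ((graft r h 0 hi (corolla 2) (corolla 2)).position : ℝ) =
      (1 + (r : ℝ)) / 2 := by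
  rw [coe_position, spineProd_of_three_leaves, above_of_ne _ (by omega),
    len_graft_crossing _ _ (by omega) _ _ _ _ (p := 1) (by omega), Set.Icc.coe_zero,
    len_graft_new _ _ (by omega) _ _ _ _ (by simp only [IsEdge]; omega) rfl (by omega)]
  ring

end MetricTree

theorem mainTheorem7 {X P : Type*} [TopologicalSpace X] [T2Space X] [CompactlyGeneratedSpace X]
    [TopologicalSpace P] [T2Space P] [CompactlyGeneratedSpace P]
    (A : AInftySpace X) (L : LeftAction A P) :
    ∃ α : Bar A.selfAction L → MoorePath (Bar A.trivialAction L),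
      Continuous α ∧
      (∀ b, (α b).length = 1) ∧
      (∀ (n : ℕ) (T : MetricTree (n + 2)) (x : X) (xs : Fin n → X) (p : P),
        (α (Bar.mk A.selfAction L T x xs p)).eval 0 =
          Bar.mk A.trivialAction L (corolla 2) () Fin.elim0 (L.act (n + 1) T (Fin.cons x xs) p)) ∧
      (∀ (n : ℕ) (T : MetricTree (n + 2)) (x : X) (xs : Fin n → X) (p : P),
        (α (Bar.mk A.selfAction L T x xs p)).eval 1 = Bar.mk A.trivialAction L T () xs p) ∧
      (∀ (x : X) (p : P) (t : ℝ≥0) (r : unitInterval), t ≤ 1 / 2 → (r : ℝ) = 1 - 2 * (t : ℝ) →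
        (α (Bar.mk A.selfAction L (corolla 2) x Fin.elim0 p)).eval t =
          Bar.mk A.trivialAction L
            (MetricTree.graft (N := 3) r (by omega) 1 (by omega) (corolla 2) (corolla 2))
            () (fun _ : Fin 1 => x) p) ∧
      (∀ (x : X) (p : P) (t : ℝ≥0) (r : unitInterval), 1 / 2 ≤ t → t ≤ 1 →
        (r : ℝ) = 2 * (t : ℝ) - 1 →
        (α (Bar.mk A.selfAction L (corolla 2) x Fin.elim0 p)).eval t =
          Bar.mk A.trivialAction L
            (MetricTree.graft (N := 3) r (by omega) 0 (by omega) (corolla 2) (corolla 2))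
            () (fun _ : Fin 1 => x) p) := by
  refine ⟨Quot.lift (fun z => CompactCoherentification.mk _ (Bar.sweepPath L z))
    fun z z' h => congrArg _ (Bar.sweepPath_eq_of_barRel L h), ?_, ?_, ?_, ?_, ?_, ?_⟩
  · exact continuous_quot_lift _ (continuous_sigma fun n =>
      (Bar.continuous_sweepPath L n).mk_compactCoherentification)
  · intro b
    induction b using Quot.ind
    rfl
  · intro n T x xs p
    change Bar.sweep L T x xs p (truncate 0) = _
    -- With `r = 1` the position is `0` and the grafting is an operad composition, so the last-leaf
    -- identification applies to all of `T`.
    obtain ⟨h1, h2⟩ := MetricTree.eraseFirst_and_position_graft_corolla (by omega) (by omega) T 1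
    rw [Bar.sweep_eq_of_eq L h1 (by rw [h2, coe_truncate zero_le_one]; simp)]
    refine (Bar.mk_comp_last A.trivialAction L (n := 0) (m := n + 1) (by omega) (corolla 2) T ()
      (Fin.cons x xs : Fin (n + 1) → X) p).trans ?_
    congr 1
    · exact funext fun k => k.elim0
    · congr 1
      funext k
      congr 1
      ext
      simp only
      omega
  · intro n T x xs p
    change Bar.sweep L T x xs p (truncate 1) = _
    rw [truncate_of_one_le le_rfl, Bar.sweep_one]
  · intro x p t r ht hr
    obtain ⟨h1, h2⟩ := MetricTree.eraseFirst_and_position_graft_corolla (by omega) (by omega)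
      (corolla (0 + 2)) r
    refine (Bar.sweep_eq_of_eq L (t := truncate t) h1 ?_ x Fin.elim0 p).trans ?_
    · rw [h2, hr, coe_truncate (ht.trans (by norm_num))]
      ring
    · congr 1
      exact funext fun k => by rw [Fin.fin_one_eq_zero k]; rfl
  · intro x p t r _ ht hr
    refine (Bar.sweep_eq_of_eq L
      (S := MetricTree.graft r (N := 0 + 3) (by omega) 0 (by omega) (corolla 2) (corolla 2))
      (t := truncate t) (MetricTree.eq_of_two_leaves _ _) ?_ x Fin.elim0 p).trans ?_
    · rw [MetricTree.position_graft_corolla_first, hr, coe_truncate ht]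
      ring
    · congr 1
      exact funext fun k => by rw [Fin.fin_one_eq_zero k]; rfl
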